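/- Let $k$ be a field of characteristic different from $2$ and $3$. A structurable algebra over $k$ is a finite-dimensional unital (not necessarily associative) $k$-algebra $A$ with a $k$-linear involution $x\mapsto\bar x$ such that $[V_{x,y},V_{z,w}]=V_{\{x\,y\,z\},w}-V_{z,\{y\,x\,w\}}$ for all $x,y,z,w\in A$, where $V_{x,y}z=\{x\,y\,z\}=(x\bar y)z+(z\bar y)x-(z\bar x)y$. Put $S=\{s\in A\mid \bar s=-s\}$, $U_xy=\{x\,y\,x\}$, $\psi(x,y)=x\bar y-y\bar x$, $L_s x=sx$, and $q_x(s)=\tfrac16\psi(x,U_x(sx))$ for $x\in A$, $s\in S$. The conjugate inverse of $u\in A$ is the element $\hat u=u^\wedge$ with $V_{u,\hat u}=\mathrm{id}$, if it exists; $A$ is a structurable division algebra if every nonzero element has a conjugate inverse. Let $\mathrm{Instrl}(A)$ be the span of the operators $V_{x,y}$, and for $D\in\mathrm{End}_k(A)$ put $D^\varepsilon=D-L_{D(1)+\overline{D(1)}}$ and $D^\delta=D+R_{\overline{D(1)}}$, where $R_a$ is right multiplication by $a$. For a scalar $c\in k^\times$ consider on $S_-\oplus A_-\oplus \mathrm{Instrl}(A)\oplus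 A_+\oplus S_+$ (summands in degrees $-2,\dots,2$) the skew-symmetric bilinear bracket with $[D,E]=DE-ED$, $[D,x_+]=(Dx)_+$, $[D,y_-]=(D^\varepsilon y)_-$, $[D,s_+]=(D^\delta s)_+$, $[D,t_-]=(D^{\varepsilon\delta}t)_-$, $[s_+,y_-]=(sy)_+$, $[t_-,x_+]=(tx)_-$, $[s_+,t_-]=L_sL_t$, $[x_+,y_-]=cV_{x,y}$, $[x_+,x'_+]=c\,\psi(x,x')_+$, $[y_-,y'_-]=c\,\psi(y,y')_-$, the other brackets of homogeneous elements being $0$. For $c=1$ this is the Lie algebra $K(A)$; let $\mathfrak g$ be the (isomorphic) Lie algebra obtained for $c=-2$. The element $\zeta=V_{1,1}=\mathrm{id}_A$ of degree $0$ acts on both as the grading derivation. For $x\in A$, $s\in S$ and $\sigma=\pm$ put $e_\sigma(x,s)=\sum_{i=0}^4\frac1{i!}\mathrm{ad}(x_\sigma+s_\sigma)^i$. The algebra $A$ is algebraic if all these maps are Lie algebra automorphisms of $K(A)$. In this case let $G\le\mathrm{Aut}(\mathfrak g)$ be the group generated by all $e_\pm(x,s)\in\mathrm{End}_k(\mathfrak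 g)$, and let $H_-$ be the set of all elements of $G$ that reverse the grading, i.e. map $\zeta$ to $-\zeta$. A pair $(x,s)\in A\times S$ is one-invertible if there are $(y,t),(z,r)\in A\times S$ with $e_-(z,r)\,e_+(x,s)\,e_-(y,t)\in H_-$, where maps act on the right ($e_-(z,r)$ is applied first); then $(y,t)$ is called the left inverse and $(z,r)$ the right inverse of $(x,s)$; both are unique. **Theorem.** Let $A$ be an algebraic structurable division algebra over $k$. (1) Let $0\ne x\in A$ and $0\ne s\in S$. Then $(x,s)$ is one-invertible. The elements $x-s(q_{\hat x}(s)x)$, $q_{\hat x}(s)+\hat s$ and $s+q_x(\hat s)$ are nonzero; let $$u=\bigl(x-s(q_{\hat x}(s)x)\bigr)^\wedge,\qquad t=\bigl(s+q_x(\hat s)\bigr)^\wedge.$$ Then $t\in S$ and $u=-\hat s\bigl((q_{\hat x}(s)+\hat s)^\wedge\,\hat x\bigr)$, and $(u,t)$ is the unique element of $A\times S$ with $$V_{x,u}=\mathrm{id}+L_sL_t,\qquad su=-\tfrac13U_x(tx),\qquad \psi(x,s(tx))=0.$$ The left inverse of $(x,s)$ is $(u-tx,t)$ and its right inverse is $(u+tx,t)$.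 (2) For $0\ne x\in A$ the left and right inverse of $(x,0)$ are both equal to $(\hat x,0)$. For $0\ne s\in S$ one has $\hat s\in S$, and the left and right inverse of $(0,s)$ are both equal to $(0,\hat s)$. (3) All elements of $A\times S\setminus\{(0,0)\}$ are one-invertible. -/

import Mathlib

noncomputable section

namespace Structurable

section Operators

variable (k : Type*) {A : Type*} [Field k] [NonAssocRing A] [StarRing A] [Module k A]
  [SMulCommClass k A A] [IsScalarTower k A A]

/-- The operator `V_{x,y} z = {x y z} = (x ȳ) z + (z ȳ) x - (z x̄) y`, where the involution of `A`
is written `star`. -/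
def V (x y : A) : Module.End k A :=
  LinearMap.mulLeft k (x * star y)
    + LinearMap.mulRight k x ∘ₗ LinearMap.mulRight k (star y)
    - LinearMap.mulRight k y ∘ₗ LinearMap.mulRight k (star x)

theorem V_apply (x y z : A) :
    V k x y z = x * star y * z + z * star y * x - z * star x * y := rfl

theorem V_one_one : V k (1 : A) 1 = 1 := by
  ext z; simp [V_apply]

/-- The operator `U_x y = {x y x}`. -/
def U (x y : A) : A := V k x y x

/-- `ψ(x, y) = x ȳ - y x̄`. -/
def psi (x y : A) : A := x * star y - y * star x

/-- `q_x(s) = (1/6) ψ(x, U_x(s x))`. -/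
def q (x s : A) : A := (6 : k)⁻¹ • psi x (U k x (s * x))

/-- `v` is a conjugate inverse of `u`: `V_{u,v} = id`. -/
def IsConjInv (u v : A) : Prop := V k u v = 1

open Classical in
/-- The conjugate inverse `û` of a conjugate invertible element `u`
(and `0` if `u` is not conjugate invertible). -/
def conjInv (u : A) : A := if h : ∃ v, IsConjInv k u v then h.choose else 0

variable (A) in
/-- `Instrl(A)`, the span of all operators `V_{x,y}`. -/
def instrl : Submodule k (Module.End k A) :=
  Submodule.span k (Set.range fun p : A × A => V k p.1 p.2)

theorem V_mem_instrl (x y : A) : V k x y ∈ instrl k A := Submodule.subset_span ⟨(x, y), rfl⟩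

/-- `V_{x,y}` as an element of `Instrl(A)`. -/
def VI (x y : A) : instrl k A := ⟨V k x y, V_mem_instrl k x y⟩

theorem VI_add_left (x y z : A) : VI k (x + y) z = VI k x z + VI k y z := by
  ext w
  simp only [VI, V_apply, Submodule.coe_add, LinearMap.add_apply, star_add, mul_add, add_mul]
  abel

theorem VI_add_right (x y z : A) : VI k x (y + z) = VI k x y + VI k x z := by
  ext w
  simp only [VI, V_apply, Submodule.coe_add, LinearMap.add_apply, star_add, mul_add, add_mul]
  abel

end Operators

/-- A structurable algebra over a field `k` of characteristic different from `2` and `3`: a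
finite-dimensional unital (not necessarily associative) `k`-algebra with a `k`-linear involution
`star` such that `[V_{x,y}, V_{z,w}] = V_{{x y z}, w} - V_{z, {y x w}}`.
(That `star` is additive, of order at most two and reverses products is part of `StarRing A`.) -/
class StructurableAlgebra (k A : Type*) [Field k] [NonAssocRing A] [StarRing A] [Module k A]
    [SMulCommClass k A A] [IsScalarTower k A A] : Prop where
  two_ne_zero : (2 : k) ≠ 0
  three_ne_zero : (3 : k) ≠ 0
  finite : Module.Finite k A
  star_smul : ∀ (c : k) (a : A), star (c • a) = c • star a
  commutator_V : ∀ x y z w : A,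
    V k x y * V k z w - V k z w * V k x y = V k (V k x y z) w - V k z (V k y x w)

theorem six_smul_cancel {k A : Type*} [Field k] [AddCommGroup A] [Module k A]
    (h2 : (2 : k) ≠ 0) (h3 : (3 : k) ≠ 0) {a : A} (h : (6 : ℤ) • a = 0) : a = 0 := by
  have h6 : (6 : k) ≠ 0 := by
    have : (6 : k) = 2 * 3 := by norm_num
    rw [this]
    exact mul_ne_zero h2 h3
  have h' : (6 : k) • a = 0 := by
    rw [← h, ← Int.cast_smul_eq_zsmul k (6 : ℤ) a]; norm_num
  exact (smul_eq_zero.mp h').resolve_left h6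

section Basic

variable (k A : Type*) [Field k] [NonAssocRing A] [StarRing A] [Module k A]
  [SMulCommClass k A A] [IsScalarTower k A A] [StructurableAlgebra k A]

/-- The space `S` of skew elements: `s̄ = -s`. -/
def skew : Submodule k A where
  carrier := {s | star s = -s}
  zero_mem' := by simp
  add_mem' := by
    intro a b ha hb
    change star a = -a at ha
    change star b = -b at hb
    change star (a + b) = -(a + b)
    rw [star_add, ha, hb]; abel
  smul_mem' := by
    intro c a ha
    change star a = -a at ha
    change star (c • a) = -(c • a)
    rw [StructurableAlgebra.star_smul, ha, smul_neg]

/-- The structurable algebra `A` is a (conjugate) division algebra: every nonzero element is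
conjugate invertible. -/
def IsDivision : Prop := ∀ u : A, u ≠ 0 → ∃ v : A, IsConjInv k u v

variable {A}

theorem triple_identity (x y z w v : A) :
    V k x y (V k z w v) - V k z w (V k x y v) = V k (V k x y z) w v - V k z (V k y x w) v := by
  have h := congrArg (fun f : Module.End k A => f v)
    (StructurableAlgebra.commutator_V (k := k) x y z w)
  simpa only [LinearMap.sub_apply, Module.End.mul_apply] using h

/-- Skew-alternativity, first half: `[s,x,y] = -[x,s,y]` for skew `s`. -/
theorem skew_alt_left {s : A} (hs : s ∈ skew k A) (x y : A) :
    s * x * y - s * (x * y) = -(x * s * y - x * (s * y)) := by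
  have hs' : star s = -s := hs
  apply sub_eq_zero.mp
  apply six_smul_cancel (StructurableAlgebra.two_ne_zero (k := k) A)
    (StructurableAlgebra.three_ne_zero (k := k) A)
  have e1 := triple_identity k s 1 (star x) 1 y
  have e2 := triple_identity k y (star x) 1 s 1
  have e3 := triple_identity k (star x) 1 1 y s
  have e4 := triple_identity k (star x) s 1 y 1
  have e5 := triple_identity k x y s 1 1
  have e6 := triple_identity k (star x) 1 s y 1
  have e7 := triple_identity k s 1 y 1 (star x)
  have e8 := triple_identity k x (star y) 1 s 1
  have e9 := triple_identity k 1 y s 1 x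
  have e10 := triple_identity k (star y) 1 (star x) s 1
  have e11 := triple_identity k s 1 x (star y) 1
  simp only [V_apply, star_one, star_star, star_mul, star_add, star_sub, star_neg, hs', mul_one,
    one_mul, mul_add, add_mul, mul_sub, sub_mul, neg_mul, mul_neg, neg_neg] at *
  linear_combination (norm := module) (2 : ℤ) • e1 - (2 : ℤ) • e2 - (1 : ℤ) • e3 - (2 : ℤ) • e4
    - (2 : ℤ) • e5 - (1 : ℤ) • e6 - (2 : ℤ) • e7 + (3 : ℤ) • e8 + (2 : ℤ) • e9 - (2 : ℤ) • e10
    - (4 : ℤ) • e11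

/-- Skew-alternativity, second half: `[s,x,y] = [x,y,s]` for skew `s`. -/
theorem skew_alt_right {s : A} (hs : s ∈ skew k A) (x y : A) :
    s * x * y - s * (x * y) = x * y * s - x * (y * s) := by
  have hs' : star s = -s := hs
  apply sub_eq_zero.mp
  apply six_smul_cancel (StructurableAlgebra.two_ne_zero (k := k) A)
    (StructurableAlgebra.three_ne_zero (k := k) A)
  have e1 := triple_identity k s 1 1 (star x) y
  have e2 := triple_identity k 1 s 1 (star x) (star y)
  have e3 := triple_identity k s 1 (star y) (star x) 1
  have e4 := triple_identity k y (star x) 1 s 1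
  have e5 := triple_identity k 1 x 1 y s
  have e6 := triple_identity k x 1 s (star y) 1
  have e7 := triple_identity k x (star y) s 1 1
  have e8 := triple_identity k s 1 (star y) x 1
  have e9 := triple_identity k y 1 s (star x) 1
  have e10 := triple_identity k 1 (star y) 1 s (star x)
  have e11 := triple_identity k (star y) 1 s 1 (star x)
  have e12 := triple_identity k x s 1 y 1
  have e13 := triple_identity k (star y) 1 s x 1
  simp only [V_apply, star_one, star_star, star_mul, star_add, star_sub, star_neg, hs', mul_one,
    one_mul, mul_add, add_mul, mul_sub, sub_mul, neg_mul, mul_neg, neg_neg] at *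
  linear_combination (norm := module) (2 : ℤ) • e1 - (3 : ℤ) • e2 - (3 : ℤ) • e3 - (4 : ℤ) • e4
    - (1 : ℤ) • e5 + (1 : ℤ) • e6 + (4 : ℤ) • e7 - (2 : ℤ) • e8 - (1 : ℤ) • e9 - (1 : ℤ) • e10
    + (1 : ℤ) • e11 + (1 : ℤ) • e12 - (1 : ℤ) • e13

/-- `D^ε = D - L_{D(1) + \overline{D(1)}}`. -/
def eps : Module.End k A →ₗ[k] Module.End k A where
  toFun D := D - LinearMap.mulLeft k (D 1 + star (D 1))
  map_add' D E := by
    ext z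
    simp only [LinearMap.sub_apply, LinearMap.add_apply, LinearMap.mulLeft_apply, star_add, add_mul]
    abel
  map_smul' c D := by
    ext z
    simp [StructurableAlgebra.star_smul, ← smul_add, ← smul_sub, smul_mul_assoc]

/-- `D^δ = D + R_{\overline{D(1)}}`. -/
def delta : Module.End k A →ₗ[k] Module.End k A where
  toFun D := D + LinearMap.mulRight k (star (D 1))
  map_add' D E := by
    ext z
    simp only [LinearMap.add_apply, LinearMap.mulRight_apply, star_add, mul_add]
    abel
  map_smul' c D := by
    ext z
    simp [StructurableAlgebra.star_smul, ← smul_add, mul_smul_comm]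

theorem eps_apply (D : Module.End k A) (z : A) :
    eps k D z = D z - (D 1 + star (D 1)) * z := rfl

theorem delta_apply (D : Module.End k A) (z : A) : delta k D z = D z + z * star (D 1) := rfl

/-- `V_{x,y}^ε = -V_{y,x}`. -/
theorem eps_V (x y : A) : eps k (V k x y) = -V k y x := by
  ext z
  simp only [eps_apply, V_apply, LinearMap.neg_apply, star_add, star_sub, star_mul, star_star,
    mul_one, one_mul, add_mul, sub_mul]
  abel

/-- `V_{x,y}^δ(s) = -ψ(x, sy)` for skew `s`. -/
theorem delta_V (x y : A) {s : A} (hs : s ∈ skew k A) :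
    delta k (V k x y) s = -psi x (s * y) := by
  have hs' : star s = -s := hs
  have hr : ∀ w : A, w - star w ∈ skew k A := fun w => by
    change star (w - star w) = -(w - star w)
    simp
  have b1 := skew_alt_left k (hr x) s y
  have b2 := skew_alt_right k (hr x) s y
  have c1 := skew_alt_left k (hr y) s x
  have c2 := skew_alt_right k (hr y) s x
  have d := skew_alt_right k hs x (star y)
  simp only [delta_apply, V_apply, psi, star_add, star_sub, star_mul, star_star, hs', mul_one,
    one_mul, mul_add, mul_sub, sub_mul, mul_neg] at *
  linear_combination (norm := module) -d - c1 + c2 + b1 - b2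

theorem eps_mem_instrl {D : Module.End k A} (hD : D ∈ instrl k A) : eps k D ∈ instrl k A := by
  suffices h : instrl k A ≤ (instrl k A).comap (eps k) from h hD
  refine Submodule.span_le.mpr ?_
  rintro _ ⟨p, rfl⟩
  change eps k (V k p.1 p.2) ∈ instrl k A
  rw [eps_V]
  exact neg_mem (V_mem_instrl k _ _)

theorem psi_mem_skew (x y : A) : psi x y ∈ skew k A := by
  change star (psi x y) = -psi x y
  simp [psi]

theorem delta_mem_skew {D : Module.End k A} (hD : D ∈ instrl k A) {s : A} (hs : s ∈ skew k A) :
    delta k D s ∈ skew k A := by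
  suffices h : instrl k A ≤ (skew k A).comap (LinearMap.applyₗ s ∘ₗ delta k) from h hD
  refine Submodule.span_le.mpr ?_
  rintro _ ⟨p, rfl⟩
  change delta k (V k p.1 p.2) s ∈ skew k A
  rw [delta_V k _ _ hs]
  exact neg_mem (psi_mem_skew k _ _)

theorem commutator_mem_instrl {D E : Module.End k A} (hD : D ∈ instrl k A)
    (hE : E ∈ instrl k A) : D * E - E * D ∈ instrl k A := by
  suffices h : instrl k A ≤ (instrl k A).comap
      (LinearMap.mulRight k E - LinearMap.mulLeft k E) from h hD
  refine Submodule.span_le.mpr ?_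
  rintro _ ⟨p, rfl⟩
  change V k p.1 p.2 * E - E * V k p.1 p.2 ∈ instrl k A
  suffices h : instrl k A ≤ (instrl k A).comap
      (LinearMap.mulLeft k (V k p.1 p.2) - LinearMap.mulRight k (V k p.1 p.2)) from h hE
  refine Submodule.span_le.mpr ?_
  rintro _ ⟨r, rfl⟩
  change V k p.1 p.2 * V k r.1 r.2 - V k r.1 r.2 * V k p.1 p.2 ∈ instrl k A
  rw [StructurableAlgebra.commutator_V]
  exact sub_mem (V_mem_instrl k _ _) (V_mem_instrl k _ _)

/-- `2 L_s L_t = V_{st,1} - V_{s,t}` for skew `s`, `t`. -/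
theorem two_smul_L_mul_L {s t : A} (hs : s ∈ skew k A) (ht : t ∈ skew k A) :
    (2 : k) • (LinearMap.mulLeft k s * LinearMap.mulLeft k t) = V k (s * t) 1 - V k s t := by
  have hs' : star s = -s := hs
  have ht' : star t = -t := ht
  ext z
  have a1 := skew_alt_left k hs z t
  have a2 := skew_alt_right k hs z t
  have a3 := skew_alt_left k ht s z
  have a4 := skew_alt_right k ht s z
  simp only [two_smul, LinearMap.add_apply, Module.End.mul_apply, LinearMap.mulLeft_apply,
    LinearMap.sub_apply, V_apply, star_one, star_mul, hs', ht', mul_one, mul_neg, neg_mul, neg_neg]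
  linear_combination (norm := module) a1 + a2 - (2 : ℤ) • a3 + (2 : ℤ) • a4

theorem L_mul_L_mem_instrl {s t : A} (hs : s ∈ skew k A) (ht : t ∈ skew k A) :
    LinearMap.mulLeft k s * LinearMap.mulLeft k t ∈ instrl k A := by
  have h2 : (2 : k) ≠ 0 := StructurableAlgebra.two_ne_zero A
  rw [← Submodule.smul_mem_iff _ h2, two_smul_L_mul_L k hs ht]
  exact sub_mem (V_mem_instrl k _ _) (V_mem_instrl k _ _)

/-- `ε` as an operator on `Instrl(A)`. -/
def epsI : instrl k A →ₗ[k] instrl k A :=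
  (eps k).restrict fun _ hD => eps_mem_instrl k hD

/-- `D^δ` as an operator on `S`, for `D` in `Instrl(A)`. -/
def deltaS (D : instrl k A) : skew k A →ₗ[k] skew k A :=
  (delta k (D : Module.End k A)).restrict fun _ hs => delta_mem_skew k D.2 hs

/-- `ψ(x, y)` as an element of `S`. -/
def psiS (x y : A) : skew k A := ⟨psi x y, psi_mem_skew k x y⟩

/-- `L_s L_t` as an element of `Instrl(A)`, for skew `s`, `t`. -/
def LL (s t : skew k A) : instrl k A :=
  ⟨LinearMap.mulLeft k (s : A) * LinearMap.mulLeft k (t : A), L_mul_L_mem_instrl k s.2 t.2⟩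

/-- The commutator `[D, E]` in `Instrl(A)`. -/
def commI (D E : instrl k A) : instrl k A :=
  ⟨(D : Module.End k A) * E - E * D, commutator_mem_instrl k D.2 E.2⟩

theorem deltaS_add (D E : instrl k A) : deltaS k (D + E) = deltaS k D + deltaS k E := by
  ext s
  exact congrArg (fun f : Module.End k A => f (s : A))
    ((delta k).map_add (D : Module.End k A) E)

theorem deltaS_smul (c : k) (D : instrl k A) : deltaS k (c • D) = c • deltaS k D := by
  ext s
  exact congrArg (fun f : Module.End k A => f (s : A))
    ((delta k).map_smul c (D : Module.End k A))

theorem psiS_add (x y z : A) : psiS k x (y + z) = psiS k x y + psiS k x z := by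
  ext
  simp only [psiS, psi, Submodule.coe_add, star_add, mul_add, add_mul]
  abel

theorem psiS_smul (c : k) (x y : A) : psiS k x (c • y) = c • psiS k x y := by
  ext
  simp [psiS, psi, StructurableAlgebra.star_smul, smul_sub, smul_mul_assoc, mul_smul_comm]

theorem VI_smul_left (c : k) (x y : A) : VI k (c • x) y = c • VI k x y := by
  ext w
  simp [VI, V_apply, StructurableAlgebra.star_smul, smul_sub, smul_add, smul_mul_assoc,
    mul_smul_comm]

theorem VI_smul_right (c : k) (x y : A) : VI k x (c • y) = c • VI k x y := by
  ext w
  simp [VI, V_apply, StructurableAlgebra.star_smul, smul_sub, smul_add, smul_mul_assoc,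
    mul_smul_comm]

theorem LL_add_left (s t r : skew k A) : LL k (s + t) r = LL k s r + LL k t r := by
  ext w
  simp [LL, add_mul]

theorem LL_add_right (s t r : skew k A) : LL k s (t + r) = LL k s t + LL k s r := by
  ext w
  simp [LL, add_mul, mul_add]

theorem LL_smul_left (c : k) (s t : skew k A) : LL k (c • s) t = c • LL k s t := by
  ext w
  simp [LL, smul_mul_assoc]

theorem LL_smul_right (c : k) (s t : skew k A) : LL k s (c • t) = c • LL k s t := by
  ext w
  simp [LL, smul_mul_assoc, mul_smul_comm]

theorem commI_add (D E F : instrl k A) : commI k D (E + F) = commI k D E + commI k D F := by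
  ext w
  simp only [commI, Submodule.coe_add, mul_add, add_mul, LinearMap.sub_apply, LinearMap.add_apply]
  abel

theorem commI_smul (c : k) (D E : instrl k A) : commI k D (c • E) = c • commI k D E := by
  ext w
  simp [commI, smul_sub]

variable (A) in
/-- The graded vector space `S₋ ⊕ A₋ ⊕ Instrl(A) ⊕ A₊ ⊕ S₊`, with summands in the degrees
`-2, -1, 0, 1, 2`. -/
abbrev K : Type _ := skew k A × A × instrl k A × A × skew k A

/-- The Lie brackets on `K k A`, depending on a scalar `c`: the nonzero brackets of homogeneous
elements are
`[D, E] = DE - ED`, `[D, x₊] = (D x)₊`, `[D, y₋] = (D^ε y)₋`, `[D, s₊] = (D^δ s)₊`,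
`[D, t₋] = (D^{εδ} t)₋`, `[s₊, y₋] = (s y)₊`, `[t₋, x₊] = (t x)₋`, `[s₊, t₋] = L_s L_t`,
`[x₊, y₋] = c V_{x,y}`, `[x₊, x'₊] = c ψ(x, x')₊`, `[y₋, y'₋] = c ψ(y, y')₋`.

For `c = 1` this is the Tits-Kantor-Koecher Lie algebra `K(A)`.
For `c = -2` it is the isomorphic Lie algebra `K'(A)`, which is also the Lie algebra `𝔤`, whose
degree `0` part is `Instrl(A) + k ζ` with `ζ` the grading derivation: the degree `0` part is
represented by its action on `A₊`, where `ζ` is the identity, which is `V_{1,1}`. -/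
def bracket (c : k) : K k A → K k A → K k A
  | (t, y, D, x, s), (t', y', D', x', s') =>
    ( deltaS k (epsI k D) t' - deltaS k (epsI k D') t + c • psiS k y y',
      (epsI k D : Module.End k A) y' - (epsI k D' : Module.End k A) y
        + ((t : A) * x' - (t' : A) * x),
      commI k D D' + c • (VI k x y' - VI k x' y) + (LL k s t' - LL k s' t),
      (D : Module.End k A) x' - (D' : Module.End k A) x + ((s : A) * y' - (s' : A) * y),
      deltaS k D s' - deltaS k D' s + c • psiS k x x' )

/-- `ad(P) = [P, ·]`. -/
def ad (c : k) (P : K k A) : Module.End k (K k A) where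
  toFun := bracket k c P
  map_add' := by
    obtain ⟨t, y, D, x, s⟩ := P
    rintro ⟨t₁, y₁, D₁, x₁, s₁⟩ ⟨t₂, y₂, D₂, x₂, s₂⟩
    refine Prod.ext ?_ (Prod.ext ?_ (Prod.ext ?_ (Prod.ext ?_ ?_)))
    · simp only [bracket, Prod.mk_add_mk, map_add, deltaS_add, psiS_add, LinearMap.add_apply]
      module
    · simp only [bracket, Prod.mk_add_mk, map_add, Submodule.coe_add, LinearMap.add_apply, mul_add,
        add_mul]
      abel
    · simp only [bracket, Prod.mk_add_mk, commI_add, VI_add_left, VI_add_right, LL_add_left,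
        LL_add_right]
      module
    · simp only [bracket, Prod.mk_add_mk, map_add, Submodule.coe_add, LinearMap.add_apply, mul_add,
        add_mul]
      abel
    · simp only [bracket, Prod.mk_add_mk, map_add, deltaS_add, psiS_add, LinearMap.add_apply]
      module
  map_smul' := by
    obtain ⟨t, y, D, x, s⟩ := P
    rintro b ⟨t₁, y₁, D₁, x₁, s₁⟩
    refine Prod.ext ?_ (Prod.ext ?_ (Prod.ext ?_ (Prod.ext ?_ ?_)))
    · simp only [bracket, Prod.smul_mk, map_smul, deltaS_smul, psiS_smul, LinearMap.smul_apply,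
        RingHom.id_apply]
      module
    · simp only [bracket, Prod.smul_mk, map_smul, Submodule.coe_smul, LinearMap.smul_apply,
        mul_smul_comm, smul_mul_assoc, RingHom.id_apply, smul_add, smul_sub]
    · simp only [bracket, Prod.smul_mk, commI_smul, VI_smul_left, VI_smul_right, LL_smul_left,
        LL_smul_right, RingHom.id_apply]
      module
    · simp only [bracket, Prod.smul_mk, map_smul, Submodule.coe_smul, LinearMap.smul_apply,
        mul_smul_comm, smul_mul_assoc, RingHom.id_apply, smul_add, smul_sub]
    · simp only [bracket, Prod.smul_mk, map_smul, deltaS_smul, psiS_smul, LinearMap.smul_apply,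
        RingHom.id_apply]
      module

/-- `exp(ad P) = ∑_{i=0}^{4} ad(P)^i / i!`. -/
def expAd (c : k) (P : K k A) : Module.End k (K k A) :=
  ∑ i ∈ Finset.range 5, ((i.factorial : ℕ) : k)⁻¹ • ad k c P ^ i

/-- `(x, s)` as the element `x₊ + s₊`. -/
def toPlus (p : A × skew k A) : K k A := (0, 0, 0, p.1, p.2)

/-- `(x, s)` as the element `x₋ + s₋`. -/
def toMinus (p : A × skew k A) : K k A := (p.2, p.1, 0, 0, 0)

/-- `f` is a Lie algebra automorphism for the bracket with parameter `c`. -/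
def IsLieAut (c : k) (f : Module.End k (K k A)) : Prop :=
  Function.Bijective f ∧ ∀ P Q : K k A, f (bracket k c P Q) = bracket k c (f P) (f Q)

variable (A) in
/-- The structurable algebra `A` is algebraic: in the `5`-graded Lie algebra `K(A)`, all
`e_σ(x, s) = exp(ad(x + s))`, `x ∈ K(A)_σ`, `s ∈ K(A)_{2σ}`, `σ = ±1`, are Lie algebra
automorphisms. -/
def IsAlgebraic : Prop :=
  ∀ p : A × skew k A,
    IsLieAut k 1 (expAd k 1 (toPlus k p)) ∧ IsLieAut k 1 (expAd k 1 (toMinus k p))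

/-- `e₊(x, s)`, an endomorphism of `𝔤`. -/
def ePlus (p : A × skew k A) : Module.End k (K k A) := expAd k (-2) (toPlus k p)

/-- `e₋(x, s)`, an endomorphism of `𝔤`. -/
def eMinus (p : A × skew k A) : Module.End k (K k A) := expAd k (-2) (toMinus k p)

variable (A) in
/-- The elementary group `G = ⟨U₊, U₋⟩` with `U_σ = {e_σ(x, s)}`. -/
def elementaryGroup : Subgroup (K k A ≃ₗ[k] K k A) :=
  Subgroup.closure {g | ∃ p : A × skew k A,
    (g : K k A →ₗ[k] K k A) = ePlus k p ∨ (g : K k A →ₗ[k] K k A) = eMinus k p}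

variable (A) in
/-- The grading element `ζ` of `𝔤`. -/
def zeta : K k A := (0, 0, VI k 1 1, 0, 0)

/-- `ad ζ` is the grading derivation. -/
theorem bracket_zeta (c : k) (t : skew k A) (y : A) (D : instrl k A) (x : A) (s : skew k A) :
    bracket k c (zeta k A) (t, y, D, x, s) = ((-2 : k) • t, -y, 0, x, (2 : k) • s) := by
  have h1 : ((VI k 1 1 : instrl k A) : Module.End k A) = 1 := V_one_one k
  have h2 : ((epsI k (VI k 1 1 : instrl k A) : instrl k A) : Module.End k A) = -1 := by
    change eps k (V k 1 1) = -1
    rw [eps_V, V_one_one]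
  refine Prod.ext ?_ (Prod.ext ?_ (Prod.ext ?_ (Prod.ext ?_ ?_)))
  · ext
    simp [bracket, zeta, deltaS, psiS, psi, h2, delta_apply, two_smul, LinearMap.restrict_apply]
  · simp [bracket, zeta, h2]
  · ext w
    simp [bracket, zeta, commI, VI, LL, V_one_one, V_apply]
  · simp [bracket, zeta, h1]
  · ext
    simp [bracket, zeta, deltaS, psiS, psi, h1, delta_apply, two_smul, LinearMap.restrict_apply]

variable (A) in
/-- The set `H₋` of all automorphisms in `G` that reverse the grading of `𝔤`,
that is, that map `ζ` to `-ζ`. -/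
def Hminus : Set (K k A ≃ₗ[k] K k A) :=
  {h | h ∈ elementaryGroup k A ∧ IsLieAut k (-2) (h : K k A →ₗ[k] K k A) ∧
    h (zeta k A) = -zeta k A}

/-- `e₋(r) e₊(p) e₋(l) ∈ H₋`, where endomorphisms act on the right, so that in this product
`e₋(r)` is applied first; thus `p` has left inverse `l` and right inverse `r`. -/
def HasInverses (p l r : A × skew k A) : Prop :=
  ∃ h ∈ Hminus k A, (h : K k A →ₗ[k] K k A) = eMinus k l ∘ₗ ePlus k p ∘ₗ eMinus k r

/-- `p` is one-invertible. -/
def OneInvertible (p : A × skew k A) : Prop :=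
  ∃ l r : A × skew k A, HasInverses k p l r

/-- `l` is the left inverse and `r` is the right inverse of `p`: the two elements
with `e₋(r) e₊(p) e₋(l) ∈ H₋` are `l` and `r`, and only these. -/
def AreTheInverses (p l r : A × skew k A) : Prop :=
  HasInverses k p l r ∧ ∀ l' r' : A × skew k A, HasInverses k p l' r' → l' = l ∧ r' = r

/-- `(u, t)` solves the system
`V_{x,u} = id + L_s L_t`, `s u = -(1/3) U_x(t x)`, `ψ(x, s (t x)) = 0`. -/
def IsSolution (x : A) (s : skew k A) (u : A) (t : skew k A) : Prop :=
  V k x u = 1 + LinearMap.mulLeft k (s : A) * LinearMap.mulLeft k (t : A) ∧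
    (s : A) * u = -((3 : k)⁻¹ • U k x ((t : A) * x)) ∧
    psi x ((s : A) * ((t : A) * x)) = 0

end Basic

end Structurable

/-!
Let `𝔤` be the 5-graded space `K k A` with the bracket for `c = -2`. It is isomorphic to `K(A)` by a
rescaling of the summands, so all `e_±(x, s)` are automorphisms of `𝔤`. Comparing components of
`e([P, Q]) = [e(P), e(Q)]` shows that `ad` of each homogeneous element of degree `±1`, `±2` is a
derivation; as the degree `0` part is spanned by the operators `V_{x,y} = -½ [x₊, y₋]`, the Jacobi
identity holds (`jacobi`) and `𝔤` is a Lie algebra, on which all computations take place.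

*One-invertibility.* Write `E = ad(x₊)`. If `(u, t)` solves the system `IsSolution`, then `e₊(x, s)`
maps `e₋(u + tx, t) ζ = ζ + (u + tx)₋ + 2 t₋` to `-e₋(-(u - tx), -t) ζ` (`eP_of_isSolution`), so
`e₋(u - tx, t) e₊(x, s) e₋(u + tx, t)` reverses the grading. An automorphism reversing the grading
interchanges `A₋ + S₋` with `A₊ + S₊`, and therefore the left and right inverses are unique
(`inverses_unique`). In particular a solution of the system is unique, and everything is reduced to
finding solutions.

*The `𝔰𝔩₂`-triple of `x`.* As `V_{x,x̂} = id`, the elements `x₊`, `x̂₋` and `ζ` span a copy of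
`𝔰𝔩₂`. On `S₋` one has `E⁴ t₋ = 24 q_x(t)₊`, and moving back with `ad(x̂₋)` shows that `q_{x̂}` is
the inverse of `q_x` (`qS_qS`). This gives the uniqueness of conjugate inverses
(`IsConjInv.unique`), and also that `L_s` is injective for `0 ≠ s ∈ S`, from which one finds that
`ŝ` is skew and `L_s L_ŝ = -id` (`exists_skew_inverse`). The automorphism
`refl = e₋(x̂, 0) e₊(x, 0) e₋(x̂, 0)` reverses the grading; it interchanges `t₋` with `q_x(t)₊` and
`s₊` with `q_{x̂}(s)₋` (`refl_sm`, `refl_sp`), and if it maps an element `D` of degree `0` to `-D`,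
then `ψ(x, Dx) = 0` and `V_{x,D^ε x̂} = -D` (`of_refl_dz`).

*The solution.* Let `m = q_{x̂}(s) + ŝ`, which is nonzero (`qS_add_ne_zero`), and put
`t = q_{x̂}(m̂)` and `u = -ŝ(m̂ x̂)`. Applying `refl` to brackets of `S₊` with `S₋` shows that
`L_s L_t = L_m̂ L_{q_{x̂}(s)}` is an operator `D` with `refl D = -D` (`LL_eq_LL`, `refl_LL`), and
that `t` is the conjugate inverse of `q_x(m) = s + q_x(ŝ)` (`qS_mul_qS_mul`). The three equations of
the system follow (`isSolution_of_inverses`). Finally `V_{x,u}` is `-(L_s L_m)⁻¹`, and the Jacobi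
identity turns this into `V_{d,u} = id` for `d = x - s(q_{x̂}(s) x)` (`isConjInv_sub`).
-/

namespace Structurable

section

theorem twentyfour_ne_zero (k A : Type*) [Field k] [NonAssocRing A] [StarRing A] [Module k A]
    [SMulCommClass k A A] [IsScalarTower k A A] [StructurableAlgebra k A] : (24 : k) ≠ 0 := by
  have h2 := StructurableAlgebra.two_ne_zero (k := k) A
  have h3 := StructurableAlgebra.three_ne_zero (k := k) A
  rw [show (24 : k) = 2 * 2 * 2 * 3 by norm_num]
  exact mul_ne_zero (mul_ne_zero (mul_ne_zero h2 h2) h2) h3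

variable (k : Type*) {A : Type*} [Field k] [NonAssocRing A] [StarRing A] [Module k A]
  [SMulCommClass k A A] [IsScalarTower k A A]

theorem inv_six : (6 : k)⁻¹ = 2⁻¹ * 3⁻¹ := by rw [← mul_inv]; norm_num

theorem inv_twentyfour : (24 : k)⁻¹ = 2⁻¹ * 2⁻¹ * 2⁻¹ * 3⁻¹ := by
  simp only [← mul_inv]; norm_num

theorem VI_zero_right (x : A) : VI k x 0 = 0 := by ext; simp [VI, V_apply]
theorem VI_zero_left (x : A) : VI k 0 x = 0 := by ext; simp [VI, V_apply]

theorem VI_neg_left (x y : A) : VI k (-x) y = -VI k x y := by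
  refine eq_neg_of_add_eq_zero_left ?_
  rw [← VI_add_left, neg_add_cancel, VI_zero_left]

theorem VI_neg_right (x y : A) : VI k x (-y) = -VI k x y := by
  refine eq_neg_of_add_eq_zero_left ?_
  rw [← VI_add_right, neg_add_cancel, VI_zero_right]

variable [StructurableAlgebra k A]

/-! ### The bracket as a bilinear map -/

theorem psi_swap (x y : A) : psi x y = -psi y x := by simp [psi]

theorem bracket_swap (c : k) (P Q : K k A) : bracket k c P Q = -bracket k c Q P := by
  obtain ⟨t, y, D, x, s⟩ := P
  obtain ⟨t', y', D', x', s'⟩ := Q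
  refine Prod.ext ?_ (Prod.ext ?_ (Prod.ext ?_ (Prod.ext ?_ ?_)))
  · have h : psiS k y y' = -psiS k y' y := Subtype.ext (psi_swap y y')
    simp only [bracket, Prod.neg_mk, h]
    module
  · simp only [bracket, Prod.neg_mk]
    abel
  · have h : commI k D D' = -commI k D' D := by ext; simp [commI]
    simp only [bracket, Prod.neg_mk, h]
    module
  · simp only [bracket, Prod.neg_mk]
    abel
  · have h : psiS k x x' = -psiS k x' x := Subtype.ext (psi_swap x x')
    simp only [bracket, Prod.neg_mk, h]
    module

theorem ad_apply (c : k) (P Q : K k A) : ad k c P Q = bracket k c P Q := rfl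

/-- The bracket of `𝔤` as a bilinear map. -/
def br : K k A →ₗ[k] Module.End k (K k A) where
  toFun := ad k (-2)
  map_add' P Q := by
    refine LinearMap.ext fun R => ?_
    change bracket k (-2) (P + Q) R = bracket k (-2) P R + bracket k (-2) Q R
    rw [bracket_swap, ← ad_apply, map_add, ad_apply, ad_apply, bracket_swap k _ P,
      bracket_swap k _ Q, neg_add]
  map_smul' a P := by
    refine LinearMap.ext fun R => ?_
    change bracket k (-2) (a • P) R = a • bracket k (-2) P R
    rw [bracket_swap, ← ad_apply, map_smul, ad_apply, bracket_swap k _ P, smul_neg]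

theorem br_eq (P Q : K k A) : br k P Q = bracket k (-2) P Q := rfl

theorem ad_eq (P : K k A) : ad k (-2) P = br k P := rfl

theorem br_swap (P Q : K k A) : br k P Q = -br k Q P := bracket_swap k (-2) P Q

/-! ### Homogeneous elements -/

/-- The inclusion of `S₋`, of degree `-2`. -/
def smK : skew k A →ₗ[k] K k A := LinearMap.inl k _ _

/-- The inclusion of `A₋`, of degree `-1`. -/
def amK : A →ₗ[k] K k A := LinearMap.inr k _ _ ∘ₗ LinearMap.inl k _ _

/-- The inclusion of `Instrl(A)`, of degree `0`. -/
def dzK : instrl k A →ₗ[k] K k A :=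
  LinearMap.inr k _ _ ∘ₗ LinearMap.inr k _ _ ∘ₗ LinearMap.inl k _ _

/-- The inclusion of `A₊`, of degree `1`. -/
def apK : A →ₗ[k] K k A :=
  LinearMap.inr k _ _ ∘ₗ LinearMap.inr k _ _ ∘ₗ LinearMap.inr k _ _ ∘ₗ LinearMap.inl k _ _

/-- The inclusion of `S₊`, of degree `2`. -/
def spK : skew k A →ₗ[k] K k A :=
  LinearMap.inr k _ _ ∘ₗ LinearMap.inr k _ _ ∘ₗ LinearMap.inr k _ _ ∘ₗ LinearMap.inr k _ _

theorem smK_apply (t : skew k A) : smK k t = (t, 0, 0, 0, 0) := rfl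
theorem amK_apply (y : A) : amK k y = (0, y, 0, 0, 0) := rfl
theorem dzK_apply (D : instrl k A) : dzK k D = (0, 0, D, 0, 0) := rfl
theorem apK_apply (x : A) : apK k x = (0, 0, 0, x, 0) := rfl
theorem spK_apply (s : skew k A) : spK k s = (0, 0, 0, 0, s) := rfl

theorem homogeneous_sum (P : K k A) :
    P = smK k P.1 + amK k P.2.1 + dzK k P.2.2.1 + apK k P.2.2.2.1 + spK k P.2.2.2.2 := by
  simp [smK_apply, amK_apply, dzK_apply, apK_apply, spK_apply]

theorem toPlus_eq (p : A × skew k A) : toPlus k p = apK k p.1 + spK k p.2 := by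
  simp [toPlus, apK_apply, spK_apply]

theorem toMinus_eq (p : A × skew k A) : toMinus k p = amK k p.1 + smK k p.2 := by
  simp [toMinus, amK_apply, smK_apply]

theorem zeta_eq : zeta k A = dzK k (VI k 1 1) := rfl

theorem deltaS_zero : deltaS k (0 : instrl k A) = 0 := by
  simpa using deltaS_smul k 0 (0 : instrl k A)

theorem psiS_zero_right (x : A) : psiS k x 0 = 0 := by ext; simp [psiS, psi]
theorem psiS_zero_left (x : A) : psiS k 0 x = 0 := by ext; simp [psiS, psi]
theorem LL_zero_right (s : skew k A) : LL k s 0 = 0 := by ext; simp [LL]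
theorem LL_zero_left (s : skew k A) : LL k 0 s = 0 := by ext; simp [LL]
theorem commI_zero_right (D : instrl k A) : commI k D 0 = 0 := by ext; simp [commI]
theorem commI_zero_left (D : instrl k A) : commI k 0 D = 0 := by ext; simp [commI]

/-- The bracket of `𝔤` in components. -/
theorem br_apply (P Q : K k A) :
    br k P Q = (deltaS k (epsI k P.2.2.1) Q.1 - deltaS k (epsI k Q.2.2.1) P.1
        + (-2 : k) • psiS k P.2.1 Q.2.1,
      (epsI k P.2.2.1 : Module.End k A) Q.2.1 - (epsI k Q.2.2.1 : Module.End k A) P.2.1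
        + ((P.1 : A) * Q.2.2.2.1 - (Q.1 : A) * P.2.2.2.1),
      commI k P.2.2.1 Q.2.2.1 + (-2 : k) • (VI k P.2.2.2.1 Q.2.1 - VI k Q.2.2.2.1 P.2.1)
        + (LL k P.2.2.2.2 Q.1 - LL k Q.2.2.2.2 P.1),
      (P.2.2.1 : Module.End k A) Q.2.2.2.1 - (Q.2.2.1 : Module.End k A) P.2.2.2.1
        + ((P.2.2.2.2 : A) * Q.2.1 - (Q.2.2.2.2 : A) * P.2.1),
      deltaS k P.2.2.1 Q.2.2.2.2 - deltaS k Q.2.2.1 P.2.2.2.2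
        + (-2 : k) • psiS k P.2.2.2.1 Q.2.2.2.1) := rfl

section Rules

variable (s t s' t' : skew k A) (x y x' y' : A) (D E : instrl k A)

theorem br_sp_sp : br k (spK k s) (spK k s') = 0 := by
  simp [br_apply, spK_apply, deltaS_zero, psiS_zero_left, VI_zero_left, LL_zero_right,
    commI_zero_left]
theorem br_sp_ap : br k (spK k s) (apK k x) = 0 := by
  simp [br_apply, spK_apply, apK_apply, deltaS_zero, psiS_zero_left, VI_zero_right, LL_zero_right,
    commI_zero_left]
theorem br_ap_sp : br k (apK k x) (spK k s) = 0 := by rw [br_swap, br_sp_ap, neg_zero]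
theorem br_sm_sm : br k (smK k t) (smK k t') = 0 := by
  simp [br_apply, smK_apply, deltaS_zero, psiS_zero_left, VI_zero_left, LL_zero_left,
    commI_zero_left]
theorem br_sm_am : br k (smK k t) (amK k y) = 0 := by
  simp [br_apply, smK_apply, amK_apply, deltaS_zero, psiS_zero_left, VI_zero_left, LL_zero_left,
    commI_zero_left]
theorem br_am_sm : br k (amK k y) (smK k t) = 0 := by rw [br_swap, br_sm_am, neg_zero]
theorem br_sp_am : br k (spK k s) (amK k y) = apK k (s * y) := by
  simp [br_apply, spK_apply, amK_apply, apK_apply, deltaS_zero, psiS_zero_left, VI_zero_left,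
    LL_zero_right, commI_zero_left]
theorem br_am_sp : br k (amK k y) (spK k s) = -apK k (s * y) := by rw [br_swap, br_sp_am]
theorem br_sm_ap : br k (smK k t) (apK k x) = amK k (t * x) := by
  simp [br_apply, smK_apply, amK_apply, apK_apply, deltaS_zero, psiS_zero_left, VI_zero_right,
    LL_zero_left, commI_zero_left]
theorem br_ap_sm : br k (apK k x) (smK k t) = -amK k (t * x) := by rw [br_swap, br_sm_ap]
theorem br_sp_sm : br k (spK k s) (smK k t) = dzK k (LL k s t) := by
  simp [br_apply, smK_apply, spK_apply, dzK_apply, deltaS_zero, psiS_zero_left, VI_zero_right,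
    LL_zero_left, commI_zero_left]
theorem br_ap_am : br k (apK k x) (amK k y) = (-2 : k) • dzK k (VI k x y) := by
  simp [br_apply, amK_apply, apK_apply, dzK_apply, deltaS_zero, psiS_zero_left, psiS_zero_right,
    VI_zero_right, LL_zero_left, commI_zero_left]
theorem br_am_ap : br k (amK k y) (apK k x) = (2 : k) • dzK k (VI k x y) := by
  rw [br_swap, br_ap_am]; module
theorem br_ap_ap : br k (apK k x) (apK k x') = (-2 : k) • spK k (psiS k x x') := by
  simp [br_apply, spK_apply, apK_apply, deltaS_zero, psiS_zero_left, VI_zero_right, LL_zero_left,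
    commI_zero_left]
theorem br_am_am : br k (amK k y) (amK k y') = (-2 : k) • smK k (psiS k y y') := by
  simp [br_apply, smK_apply, amK_apply, deltaS_zero, psiS_zero_left, VI_zero_left, LL_zero_left,
    commI_zero_left]
theorem br_dz_dz : br k (dzK k D) (dzK k E) = dzK k (commI k D E) := by
  simp [br_apply, dzK_apply, psiS_zero_left, VI_zero_left, LL_zero_left]
theorem br_dz_ap : br k (dzK k D) (apK k x) = apK k ((D : Module.End k A) x) := by
  simp [br_apply, dzK_apply, apK_apply, psiS_zero_left, VI_zero_right, LL_zero_left, deltaS_zero,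
    commI_zero_right]
theorem br_ap_dz : br k (apK k x) (dzK k D) = -apK k ((D : Module.End k A) x) := by
  rw [br_swap, br_dz_ap]
theorem br_dz_am : br k (dzK k D) (amK k y) = amK k (eps k D y) := by
  have h : ((epsI k D : instrl k A) : Module.End k A) = eps k D := rfl
  simp [br_apply, dzK_apply, amK_apply, psiS_zero_left, VI_zero_left, LL_zero_left, deltaS_zero,
    commI_zero_right, h]
theorem br_am_dz : br k (amK k y) (dzK k D) = -amK k (eps k D y) := by
  rw [br_swap, br_dz_am]
theorem br_dz_sp : br k (dzK k D) (spK k s) = spK k (deltaS k D s) := by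
  simp [br_apply, dzK_apply, spK_apply, psiS_zero_left, VI_zero_left, LL_zero_right, deltaS_zero,
    commI_zero_right]
theorem br_zeta (P : K k A) : br k (zeta k A) P =
    ((-2 : k) • P.1, -P.2.1, 0, P.2.2.2.1, (2 : k) • P.2.2.2.2) :=
  bracket_zeta k (-2) P.1 P.2.1 P.2.2.1 P.2.2.2.1 P.2.2.2.2

end Rules

-- the rules above are all that is needed, and unfolding the bracket is expensive
attribute [irreducible] br smK amK dzK apK spK

/-! ### The grading -/

/-- The homogeneous elements of degree `n`. -/
def gr (n : ℤ) : Submodule k (K k A) where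
  carrier := {P | (n ≠ -2 → P.1 = 0) ∧ (n ≠ -1 → P.2.1 = 0) ∧ (n ≠ 0 → P.2.2.1 = 0) ∧
    (n ≠ 1 → P.2.2.2.1 = 0) ∧ (n ≠ 2 → P.2.2.2.2 = 0)}
  zero_mem' := by simp
  add_mem' := by
    rintro P Q ⟨h1, h2, h3, h4, h5⟩ ⟨h1', h2', h3', h4', h5'⟩
    refine ⟨fun h => ?_, fun h => ?_, fun h => ?_, fun h => ?_, fun h => ?_⟩ <;> simp [*]
  smul_mem' := by
    rintro a P ⟨h1, h2, h3, h4, h5⟩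
    refine ⟨fun h => ?_, fun h => ?_, fun h => ?_, fun h => ?_, fun h => ?_⟩ <;> simp [*]

theorem smK_mem (t : skew k A) : smK k t ∈ gr k (A := A) (-2) := by simp [gr, smK_apply]
theorem amK_mem (y : A) : amK k y ∈ gr k (A := A) (-1) := by simp [gr, amK_apply]
theorem dzK_mem (D : instrl k A) : dzK k D ∈ gr k (A := A) 0 := by simp [gr, dzK_apply]
theorem apK_mem (x : A) : apK k x ∈ gr k (A := A) 1 := by simp [gr, apK_apply]
theorem spK_mem (s : skew k A) : spK k s ∈ gr k (A := A) 2 := by simp [gr, spK_apply]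

theorem br_mem {i j : ℤ} {P Q : K k A} (hP : P ∈ gr k (A := A) i) (hQ : Q ∈ gr k (A := A) j) :
    br k P Q ∈ gr k (A := A) (i + j) := by
  obtain ⟨h1, h2, h3, h4, h5⟩ := hP
  obtain ⟨h1', h2', h3', h4', h5'⟩ := hQ
  -- two components of total degree different from that of the target cannot both be nonzero
  have key : ∀ {M N : Type _} [Zero M] [Zero N] {a b n : ℤ} {v : M} {w : N},
      (i ≠ a → v = 0) → (j ≠ b → w = 0) → i + j ≠ n → a + b = n → v = 0 ∨ w = 0 := by
    intro M N _ _ a b n v w hv hw hn hab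
    by_cases hi : i = a
    · exact Or.inr (hw (by omega))
    · exact Or.inl (hv hi)
  rw [br_apply]
  refine ⟨fun h => ?_, fun h => ?_, fun h => ?_, fun h => ?_, fun h => ?_⟩
  · have a1 := key h3 h1' h rfl
    have a2 := key h1 h3' h rfl
    have a3 := key h2 h2' h rfl
    rcases a1 with e1 | e1 <;> rcases a2 with e2 | e2 <;> rcases a3 with e3 | e3 <;>
      simp [e1, e2, e3, deltaS_zero, psiS_zero_left, psiS_zero_right]
  · have a1 := key h3 h2' h rfl
    have a2 := key h2 h3' h rfl
    have a3 := key h1 h4' h rfl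
    have a4 := key h4 h1' h rfl
    rcases a1 with e1 | e1 <;> rcases a2 with e2 | e2 <;> rcases a3 with e3 | e3 <;>
      rcases a4 with e4 | e4 <;> simp [e1, e2, e3, e4]
  · have a1 := key h3 h3' h rfl
    have a2 := key h4 h2' h rfl
    have a3 := key h2 h4' h rfl
    have a4 := key h5 h1' h rfl
    have a5 := key h1 h5' h rfl
    rcases a1 with e1 | e1 <;> rcases a2 with e2 | e2 <;> rcases a3 with e3 | e3 <;>
      rcases a4 with e4 | e4 <;> rcases a5 with e5 | e5 <;>
      simp [e1, e2, e3, e4, e5, commI_zero_left, commI_zero_right, VI_zero_left, VI_zero_right,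
        LL_zero_left, LL_zero_right]
  · have a1 := key h3 h4' h rfl
    have a2 := key h4 h3' h rfl
    have a3 := key h5 h2' h rfl
    have a4 := key h2 h5' h rfl
    rcases a1 with e1 | e1 <;> rcases a2 with e2 | e2 <;> rcases a3 with e3 | e3 <;>
      rcases a4 with e4 | e4 <;> simp [e1, e2, e3, e4]
  · have a1 := key h3 h5' h rfl
    have a2 := key h5 h3' h rfl
    have a3 := key h4 h4' h rfl
    rcases a1 with e1 | e1 <;> rcases a2 with e2 | e2 <;> rcases a3 with e3 | e3 <;>
      simp [e1, e2, e3, deltaS_zero, psiS_zero_left, psiS_zero_right]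

/-- The projection onto the homogeneous component of degree `n`. -/
def pr (n : ℤ) : K k A →ₗ[k] K k A where
  toFun P := (if n = -2 then P.1 else 0, if n = -1 then P.2.1 else 0, if n = 0 then P.2.2.1 else 0,
    if n = 1 then P.2.2.2.1 else 0, if n = 2 then P.2.2.2.2 else 0)
  map_add' P Q := by
    refine Prod.ext ?_ (Prod.ext ?_ (Prod.ext ?_ (Prod.ext ?_ ?_))) <;> dsimp <;> split_ifs <;> simp
  map_smul' a P := by
    refine Prod.ext ?_ (Prod.ext ?_ (Prod.ext ?_ (Prod.ext ?_ ?_))) <;> dsimp <;> split_ifs <;> simp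

theorem pr_of_mem {n : ℤ} {P : K k A} (hP : P ∈ gr k (A := A) n) : pr k n P = P := by
  obtain ⟨h1, h2, h3, h4, h5⟩ := hP
  refine Prod.ext ?_ (Prod.ext ?_ (Prod.ext ?_ (Prod.ext ?_ ?_)))
  · exact ite_eq_left_iff.mpr fun h => (h1 h).symm
  · exact ite_eq_left_iff.mpr fun h => (h2 h).symm
  · exact ite_eq_left_iff.mpr fun h => (h3 h).symm
  · exact ite_eq_left_iff.mpr fun h => (h4 h).symm
  · exact ite_eq_left_iff.mpr fun h => (h5 h).symm

theorem pr_of_mem_of_ne {n m : ℤ} {P : K k A} (hP : P ∈ gr k (A := A) m) (hnm : m ≠ n) :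
    pr k n P = 0 := by
  obtain ⟨h1, h2, h3, h4, h5⟩ := hP
  refine Prod.ext ?_ (Prod.ext ?_ (Prod.ext ?_ (Prod.ext ?_ ?_)))
  · exact ite_eq_right_iff.mpr fun h => h1 (by omega)
  · exact ite_eq_right_iff.mpr fun h => h2 (by omega)
  · exact ite_eq_right_iff.mpr fun h => h3 (by omega)
  · exact ite_eq_right_iff.mpr fun h => h4 (by omega)
  · exact ite_eq_right_iff.mpr fun h => h5 (by omega)

theorem eq_zero_of_mem {n : ℤ} {P : K k A} (hP : P ∈ gr k (A := A) n) (hn : 2 < n ∨ n < -2) :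
    P = 0 := by
  obtain ⟨h1, h2, h3, h4, h5⟩ := hP
  exact Prod.ext (h1 (by omega)) (Prod.ext (h2 (by omega)) (Prod.ext (h3 (by omega))
    (Prod.ext (h4 (by omega)) (h5 (by omega)))))

theorem pow_br_mem {d n : ℤ} {X P : K k A} (hX : X ∈ gr k (A := A) d) (hP : P ∈ gr k (A := A) n)
    (i : ℕ) : (br k X ^ i) P ∈ gr k (A := A) (n + i * d) := by
  induction i with
  | zero => simpa using hP
  | succ i ih =>
    rw [pow_succ', Module.End.mul_apply]
    convert br_mem k hX ih using 2
    push_cast; ring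

/-- A condition closed under addition can be checked on homogeneous elements. -/
theorem homogeneous_induction {p : K k A → Prop} (hadd : ∀ P Q, p P → p Q → p (P + Q))
    (hhom : ∀ n : ℤ, ∀ P ∈ gr k (A := A) n, p P) (P : K k A) : p P := by
  rw [homogeneous_sum k P]
  exact hadd _ _ (hadd _ _ (hadd _ _ (hadd _ _ (hhom _ _ (smK_mem k _)) (hhom _ _ (amK_mem k _)))
    (hhom _ _ (dzK_mem k _))) (hhom _ _ (apK_mem k _))) (hhom _ _ (spK_mem k _))

end

section

/-! ### Derivations of a bilinear product -/

section Derivations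

variable {k V : Type*} [Field k] [AddCommGroup V] [Module k V]

/-- The bracket with `X` is a derivation of the bilinear product `B`. -/
def IsDer (B : V →ₗ[k] Module.End k V) (X : V) : Prop :=
  ∀ P Q : V, B X (B P Q) = B (B X P) Q + B P (B X Q)

variable {B : V →ₗ[k] Module.End k V} {X Y : V}

theorem IsDer.bracket (hX : IsDer B X) (hY : IsDer B Y) : IsDer B (B X Y) := by
  have e : ∀ P, B (B X Y) P = B X (B Y P) - B Y (B X P) := fun P => by
    rw [hX Y P]; abel
  intro P Q
  rw [e (B P Q), e P, e Q, hY P Q, hX P Q, map_add, map_add, hX (B Y P) Q, hX P (B Y Q),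
    hY (B X P) Q, hY P (B X Q), map_sub, map_sub, LinearMap.sub_apply]
  abel

theorem IsDer.add (hX : IsDer B X) (hY : IsDer B Y) : IsDer B (X + Y) := by
  intro P Q
  simp only [map_add, LinearMap.add_apply, hX P Q, hY P Q]
  abel

theorem IsDer.smul (a : k) (hX : IsDer B X) : IsDer B (a • X) := by
  intro P Q
  simp only [map_smul, LinearMap.smul_apply, hX P Q, smul_add]

end Derivations

variable (k : Type*) {A : Type*} [Field k] [NonAssocRing A] [StarRing A] [Module k A]
  [SMulCommClass k A A] [IsScalarTower k A A]
variable [StructurableAlgebra k A]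

/-! ### Exponentials as automorphisms and the Jacobi identity -/

/-- The isomorphism from `K(A)` to `𝔤`: it scales `S₋` and `A₋` by `-1/2` and `S₊` by `-2`. -/
def rescale : K k A →ₗ[k] K k A :=
  (-(2 : k)⁻¹ • LinearMap.id).prodMap ((-(2 : k)⁻¹ • LinearMap.id).prodMap
    (LinearMap.id.prodMap (LinearMap.id.prodMap ((-2 : k) • LinearMap.id))))

theorem rescale_apply (P : K k A) : rescale k P =
    (-(2 : k)⁻¹ • P.1, -(2 : k)⁻¹ • P.2.1, P.2.2.1, P.2.2.2.1, (-2 : k) • P.2.2.2.2) := rfl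

theorem psiS_smul_left (c : k) (x y : A) : psiS k (c • x) y = c • psiS k x y := by
  ext
  simp [psiS, psi, StructurableAlgebra.star_smul, smul_sub, smul_mul_assoc, mul_smul_comm]

theorem rescale_bracket (P Q : K k A) :
    rescale k (bracket k 1 P Q) = bracket k (-2) (rescale k P) (rescale k Q) := by
  have h2 := StructurableAlgebra.two_ne_zero (k := k) A
  obtain ⟨t, y, D, x, s⟩ := P
  obtain ⟨t', y', D', x', s'⟩ := Q
  refine Prod.ext ?_ (Prod.ext ?_ (Prod.ext ?_ (Prod.ext ?_ ?_)))
  · simp only [rescale_apply, bracket, psiS_smul_left, psiS_smul,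
      map_smul]
    match_scalars <;> field_simp
  · simp only [rescale_apply, bracket, map_smul, Submodule.coe_smul,
      smul_mul_assoc]
    match_scalars <;> field_simp
  · simp only [rescale_apply, bracket, map_smul, VI_smul_right,
      LL_smul_left, LL_smul_right]
    match_scalars <;> field_simp
  · simp only [rescale_apply, bracket, map_smul, Submodule.coe_smul,
      smul_mul_assoc, mul_smul_comm]
    match_scalars <;> field_simp
  · simp only [rescale_apply, bracket, map_smul]
    match_scalars <;> field_simp

theorem rescale_bijective : Function.Bijective (rescale k (A := A)) := by
  have h2 := StructurableAlgebra.two_ne_zero (k := k) A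
  refine Function.bijective_iff_has_inverse.mpr ⟨fun P =>
    ((-2 : k) • P.1, (-2 : k) • P.2.1, P.2.2.1, P.2.2.2.1, -(2 : k)⁻¹ • P.2.2.2.2), ?_, ?_⟩ <;>
  · intro P
    refine Prod.ext ?_ (Prod.ext ?_ (Prod.ext ?_ (Prod.ext ?_ ?_))) <;>
      simp [rescale_apply, smul_smul, h2]

theorem expAd_comp {c c' : k} {f : Module.End k (K k A)}
    (hf : ∀ P Q : K k A, f (bracket k c P Q) = bracket k c' (f P) (f Q)) (P Q : K k A) :
    f (expAd k c P Q) = expAd k c' (f P) (f Q) := by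
  have h : ∀ i : ℕ, f ((ad k c P ^ i) Q) = (ad k c' (f P) ^ i) (f Q) := by
    intro i
    induction i with
    | zero => rfl
    | succ i ih =>
      rw [pow_succ', pow_succ', Module.End.mul_apply, Module.End.mul_apply, ad_apply, hf, ih]
      rfl
  simp only [expAd, LinearMap.sum_apply, LinearMap.smul_apply, map_sum, map_smul, h]

theorem isLieAut_expAd_rescale {P : K k A} (hP : IsLieAut k 1 (expAd k 1 P)) :
    IsLieAut k (-2) (expAd k (-2) (rescale k P)) := by
  have hr := rescale_bracket k (A := A)
  have hb := rescale_bijective k (A := A)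
  have hc : ∀ Q, expAd k (-2) (rescale k P) (rescale k Q) = rescale k (expAd k 1 P Q) := fun Q =>
    (expAd_comp k hr P Q).symm
  refine ⟨?_, fun Q R => ?_⟩
  · refine (Function.Bijective.of_comp_iff _ hb).mp ?_
    have : ⇑(expAd k (-2) (rescale k P)) ∘ ⇑(rescale k) = ⇑(rescale k) ∘ ⇑(expAd k 1 P) :=
      funext hc
    rw [this]
    exact hb.comp hP.1
  · obtain ⟨Q, rfl⟩ := hb.2 Q
    obtain ⟨R, rfl⟩ := hb.2 R
    rw [← hr, hc, hc, hc, hP.2, hr]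

variable {k}

theorem isLieAut_ePlus (halg : IsAlgebraic k A) (p : A × skew k A) :
    IsLieAut k (-2) (ePlus k p) := by
  have h2 := StructurableAlgebra.two_ne_zero (k := k) A
  have h := isLieAut_expAd_rescale k (halg (p.1, -(2 : k)⁻¹ • p.2)).1
  have e : rescale k (toPlus k (p.1, -(2 : k)⁻¹ • p.2)) = toPlus k p := by
    simp [rescale_apply, toPlus, smul_smul, h2]
  rwa [e] at h

theorem isLieAut_eMinus (halg : IsAlgebraic k A) (p : A × skew k A) :
    IsLieAut k (-2) (eMinus k p) := by
  have h2 := StructurableAlgebra.two_ne_zero (k := k) A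
  have h := isLieAut_expAd_rescale k (halg ((-2 : k) • p.1, (-2 : k) • p.2)).2
  have e : rescale k (toMinus k ((-2 : k) • p.1, (-2 : k) • p.2)) = toMinus k p := by
    simp [rescale_apply, toMinus, smul_smul, h2]
  rwa [e] at h

theorem expAd_apply (P Q : K k A) : expAd k (-2) P Q =
    Q + br k P Q + (2 : k)⁻¹ • br k P (br k P Q) + (6 : k)⁻¹ • br k P (br k P (br k P Q))
      + (24 : k)⁻¹ • br k P (br k P (br k P (br k P Q))) := by
  have h : ad k (-2) P = br k P := ad_eq k P
  simp [expAd, Finset.sum_range_succ, h, pow_succ, Nat.factorial]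

theorem IsLieAut.map_br {f : Module.End k (K k A)} (hf : IsLieAut k (-2) f) (P Q : K k A) :
    f (br k P Q) = br k (f P) (f Q) := by
  rw [br_eq, br_eq]
  exact hf.2 P Q

/-- Comparing the components of the right degree in `e([P, Q]) = [e(P), e(Q)]`. -/
theorem isDer_of_isLieAut {d : ℤ} (hd : d ≠ 0) {X : K k A} (hX : X ∈ gr k (A := A) d)
    (h : IsLieAut k (-2) (expAd k (-2) X)) : IsDer (br k) X := by
  intro P
  induction P using homogeneous_induction k with
  | hadd P P' hP hP' => intro Q; simp only [map_add, LinearMap.add_apply, hP, hP']; abel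
  | hhom i P hP =>
    intro Q
    induction Q using homogeneous_induction k with
    | hadd Q Q' hQ hQ' => simp only [map_add, hQ, hQ']; abel
    | hhom j Q hQ =>
      have e : ∀ R, expAd k (-2) X R =
          ∑ a ∈ Finset.range 5, ((a.factorial : ℕ) : k)⁻¹ • (br k X ^ a) R := by
        intro R
        simp only [expAd, LinearMap.sum_apply, LinearMap.smul_apply, ad_eq]
      have h1 := congrArg (pr k (i + j + d)) (h.map_br P Q)
      have hl : ∀ a : ℕ, pr k (i + j + d) ((br k X ^ a) (br k P Q)) =
          if a = 1 then br k X (br k P Q) else 0 := by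
        intro a
        have m := pow_br_mem k hX (br_mem k hP hQ) a
        split_ifs with ha
        · subst ha
          rw [pow_one] at m ⊢
          exact pr_of_mem k (by simpa using m)
        · refine pr_of_mem_of_ne k m fun hn => ha ?_
          have : ((a : ℤ) - 1) * d = 0 := by linear_combination hn
          rcases mul_eq_zero.mp this with h0 | h0
          · omega
          · exact absurd h0 hd
      have hr : ∀ a b : ℕ, pr k (i + j + d) (br k ((br k X ^ a) P) ((br k X ^ b) Q)) =
          if a + b = 1 then br k ((br k X ^ a) P) ((br k X ^ b) Q) else 0 := by
        intro a b
        have m := br_mem k (pow_br_mem k hX hP a) (pow_br_mem k hX hQ b)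
        have e1 : i + a * d + (j + b * d) = i + j + (a + b : ℕ) * d := by push_cast; ring
        rw [e1] at m
        split_ifs with ha
        · rw [ha] at m
          exact pr_of_mem k (by simpa using m)
        · refine pr_of_mem_of_ne k m fun hn => ha ?_
          have : (((a + b : ℕ) : ℤ) - 1) * d = 0 := by linear_combination hn
          rcases mul_eq_zero.mp this with h0 | h0
          · omega
          · exact absurd h0 hd
      rw [e, e, e] at h1
      simp only [map_sum, map_smul, LinearMap.sum_apply, LinearMap.smul_apply, hl, hr] at h1
      simpa [Finset.sum_range_succ] using h1

section

variable (halg : IsAlgebraic k A)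
include halg

theorem isDer_apK (x : A) : IsDer (br k) (apK k x) :=
  isDer_of_isLieAut one_ne_zero (apK_mem k x) <| by
    simpa [ePlus, toPlus_eq] using isLieAut_ePlus halg (x, 0)

theorem isDer_amK (x : A) : IsDer (br k) (amK k x) :=
  isDer_of_isLieAut (by norm_num) (amK_mem k x) <| by
    simpa [eMinus, toMinus_eq] using isLieAut_eMinus halg (x, 0)

theorem isDer_spK (s : skew k A) : IsDer (br k) (spK k s) :=
  isDer_of_isLieAut two_ne_zero (spK_mem k s) <| by
    simpa [ePlus, toPlus_eq] using isLieAut_ePlus halg (0, s)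

theorem isDer_smK (s : skew k A) : IsDer (br k) (smK k s) :=
  isDer_of_isLieAut (by norm_num) (smK_mem k s) <| by
    simpa [eMinus, toMinus_eq] using isLieAut_eMinus halg (0, s)

theorem isDer_VI (x y : A) : IsDer (br k) (dzK k (VI k x y)) := by
  have h2 := StructurableAlgebra.two_ne_zero (k := k) A
  have h := ((isDer_apK halg x).bracket (isDer_amK halg y)).smul (-(2 : k)⁻¹)
  rw [br_ap_am, smul_smul] at h
  simpa [h2] using h

theorem isDer_dzK (D : instrl k A) : IsDer (br k) (dzK k D) := by
  obtain ⟨D, hD⟩ := D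
  induction hD using Submodule.span_induction with
  | mem D hD =>
    obtain ⟨p, rfl⟩ := hD
    exact isDer_VI halg p.1 p.2
  | zero => intro P Q; simp [show (⟨0, _⟩ : instrl k A) = 0 from rfl]
  | add D E hD hE h h' =>
    have := h.add h'
    rwa [← map_add] at this
  | smul a D hD h =>
    have := h.smul a
    rwa [← map_smul] at this

/-- For an algebraic structurable algebra, `𝔤` satisfies the Jacobi identity. -/
theorem jacobi (X : K k A) : IsDer (br k) X := by
  rw [homogeneous_sum k X]
  exact ((((isDer_smK halg _).add (isDer_amK halg _)).add (isDer_dzK halg _)).add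
    (isDer_apK halg _)).add (isDer_spK halg _)

end

end

section

variable (k : Type*) {A : Type*} [Field k] [NonAssocRing A] [StarRing A] [Module k A]
  [SMulCommClass k A A] [IsScalarTower k A A]
variable [StructurableAlgebra k A]

/-! ### The Lie algebra -/

variable (A) in
/-- The Lie algebra `𝔤`: the space `K k A` with the bracket for `c = -2`. It is a type of its own in
order to carry an instance of `LieRing`. -/
def TKK : Type _ := K k A

instance : AddCommGroup (TKK k A) := inferInstanceAs (AddCommGroup (K k A))

instance : Module k (TKK k A) := inferInstanceAs (Module k (K k A))

instance [h : Fact (IsAlgebraic k A)] : LieRing (TKK k A) where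
  bracket P Q := br k (A := A) P Q
  add_lie P Q R := LinearMap.congr_fun ((br k (A := A)).map_add P Q) R
  lie_add P Q R := (br k (A := A) P).map_add Q R
  lie_self P := by
    have h2 := StructurableAlgebra.two_ne_zero (k := k) A
    have e : br k (A := A) P P = -br k (A := A) P P := br_swap k P P
    have e2 : (2 : k) • br k (A := A) P P = 0 := by
      rw [two_smul]; nth_rewrite 2 [e]; rw [add_neg_cancel]
    exact (smul_eq_zero.mp e2).resolve_left h2
  leibniz_lie P Q R := jacobi h.out P Q R

instance [h : Fact (IsAlgebraic k A)] : LieAlgebra k (TKK k A) where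
  lie_smul a P Q := (br k (A := A) P).map_smul a Q

/-- The inclusion of `S₋`, of degree `-2`. -/
def sm : skew k A →ₗ[k] TKK k A := smK k
/-- The inclusion of `A₋`, of degree `-1`. -/
def am : A →ₗ[k] TKK k A := amK k
/-- The inclusion of `Instrl(A)`, of degree `0`. -/
def dz : instrl k A →ₗ[k] TKK k A := dzK k
/-- The inclusion of `A₊`, of degree `1`. -/
def ap : A →ₗ[k] TKK k A := apK k
/-- The inclusion of `S₊`, of degree `2`. -/
def sp : skew k A →ₗ[k] TKK k A := spK k
/-- The projection to `S₋`. -/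
def csm : TKK k A →ₗ[k] skew k A := LinearMap.fst k _ _
/-- The projection to `A₋`. -/
def cam : TKK k A →ₗ[k] A := LinearMap.fst k _ _ ∘ₗ LinearMap.snd k _ _
/-- The projection to `Instrl(A)`. -/
def cdz : TKK k A →ₗ[k] instrl k A :=
  LinearMap.fst k _ _ ∘ₗ LinearMap.snd k _ _ ∘ₗ LinearMap.snd k _ _
/-- The projection to `A₊`. -/
def cap : TKK k A →ₗ[k] A :=
  LinearMap.fst k _ _ ∘ₗ LinearMap.snd k _ _ ∘ₗ LinearMap.snd k _ _ ∘ₗ LinearMap.snd k _ _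
/-- The projection to `S₊`. -/
def csp : TKK k A →ₗ[k] skew k A :=
  LinearMap.snd k _ _ ∘ₗ LinearMap.snd k _ _ ∘ₗ LinearMap.snd k _ _ ∘ₗ LinearMap.snd k _ _

theorem decompose (P : TKK k A) :
    P = sm k (csm k P) + am k (cam k P) + dz k (cdz k P) + ap k (cap k P) + sp k (csp k P) :=
  homogeneous_sum k (A := A) P

section Components

variable (s t : skew k A) (x y : A) (D : instrl k A)

@[simp] theorem csm_sm : csm k (sm k t) = t := by unfold csm sm smK; rfl
@[simp] theorem cam_sm : cam k (sm k t) = 0 := by unfold cam sm smK; rfl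
@[simp] theorem cdz_sm : cdz k (sm k t) = 0 := by unfold cdz sm smK; rfl
@[simp] theorem cap_sm : cap k (sm k t) = 0 := by unfold cap sm smK; rfl
@[simp] theorem csp_sm : csp k (sm k t) = 0 := by unfold csp sm smK; rfl
@[simp] theorem csm_am : csm k (am k y) = 0 := by unfold csm am amK; rfl
@[simp] theorem cam_am : cam k (am k y) = y := by unfold cam am amK; rfl
@[simp] theorem cdz_am : cdz k (am k y) = 0 := by unfold cdz am amK; rfl
@[simp] theorem cap_am : cap k (am k y) = 0 := by unfold cap am amK; rfl
@[simp] theorem csp_am : csp k (am k y) = 0 := by unfold csp am amK; rfl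
@[simp] theorem csm_dz : csm k (dz k D) = 0 := by unfold csm dz dzK; rfl
@[simp] theorem cam_dz : cam k (dz k D) = 0 := by unfold cam dz dzK; rfl
@[simp] theorem cdz_dz : cdz k (dz k D) = D := by unfold cdz dz dzK; rfl
@[simp] theorem cap_dz : cap k (dz k D) = 0 := by unfold cap dz dzK; rfl
@[simp] theorem csp_dz : csp k (dz k D) = 0 := by unfold csp dz dzK; rfl
@[simp] theorem csm_ap : csm k (ap k x) = 0 := by unfold csm ap apK; rfl
@[simp] theorem cam_ap : cam k (ap k x) = 0 := by unfold cam ap apK; rfl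
@[simp] theorem cdz_ap : cdz k (ap k x) = 0 := by unfold cdz ap apK; rfl
@[simp] theorem cap_ap : cap k (ap k x) = x := by unfold cap ap apK; rfl
@[simp] theorem csp_ap : csp k (ap k x) = 0 := by unfold csp ap apK; rfl
@[simp] theorem csm_sp : csm k (sp k s) = 0 := by unfold csm sp spK; rfl
@[simp] theorem cam_sp : cam k (sp k s) = 0 := by unfold cam sp spK; rfl
@[simp] theorem cdz_sp : cdz k (sp k s) = 0 := by unfold cdz sp spK; rfl
@[simp] theorem cap_sp : cap k (sp k s) = 0 := by unfold cap sp spK; rfl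
@[simp] theorem csp_sp : csp k (sp k s) = s := by unfold csp sp spK; rfl

theorem sm_injective : Function.Injective (sm k (A := A)) :=
  Function.LeftInverse.injective (csm_sm k)
theorem am_injective : Function.Injective (am k (A := A)) :=
  Function.LeftInverse.injective (cam_am k)
theorem dz_injective : Function.Injective (dz k (A := A)) :=
  Function.LeftInverse.injective (cdz_dz k)
theorem ap_injective : Function.Injective (ap k (A := A)) :=
  Function.LeftInverse.injective (cap_ap k)
theorem sp_injective : Function.Injective (sp k (A := A)) :=
  Function.LeftInverse.injective (csp_sp k)

end Components

variable (A) in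
/-- The grading element as an element of `𝔤`. -/
def ze : TKK k A := zeta k A

theorem ze_eq : ze k A = dz k (VI k 1 1) := zeta_eq k

section Rules

variable [Fact (IsAlgebraic k A)]
variable (s t s' t' : skew k A) (x y x' y' : A) (D E : instrl k A)

theorem lie_def (P Q : TKK k A) : ⁅P, Q⁆ = br k (A := A) P Q := rfl

@[simp] theorem lie_sp_sp : ⁅sp k s, sp k s'⁆ = 0 := br_sp_sp k s s'
@[simp] theorem lie_sp_ap : ⁅sp k s, ap k x⁆ = 0 := br_sp_ap k s x
@[simp] theorem lie_ap_sp : ⁅ap k x, sp k s⁆ = 0 := br_ap_sp k s x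
@[simp] theorem lie_sm_sm : ⁅sm k t, sm k t'⁆ = 0 := br_sm_sm k t t'
@[simp] theorem lie_sm_am : ⁅sm k t, am k y⁆ = 0 := br_sm_am k t y
@[simp] theorem lie_am_sm : ⁅am k y, sm k t⁆ = 0 := br_am_sm k t y
@[simp] theorem lie_sp_am : ⁅sp k s, am k y⁆ = ap k (s * y) := br_sp_am k s y
@[simp] theorem lie_am_sp : ⁅am k y, sp k s⁆ = -ap k (s * y) := br_am_sp k s y
@[simp] theorem lie_sm_ap : ⁅sm k t, ap k x⁆ = am k (t * x) := br_sm_ap k t x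
@[simp] theorem lie_ap_sm : ⁅ap k x, sm k t⁆ = -am k (t * x) := br_ap_sm k t x
@[simp] theorem lie_sp_sm : ⁅sp k s, sm k t⁆ = dz k (LL k s t) := br_sp_sm k s t
@[simp] theorem lie_ap_am : ⁅ap k x, am k y⁆ = (-2 : k) • dz k (VI k x y) := br_ap_am k x y
@[simp] theorem lie_am_ap : ⁅am k y, ap k x⁆ = (2 : k) • dz k (VI k x y) := br_am_ap k x y
@[simp] theorem lie_ap_ap : ⁅ap k x, ap k x'⁆ = (-2 : k) • sp k (psiS k x x') := br_ap_ap k x x'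
@[simp] theorem lie_am_am : ⁅am k y, am k y'⁆ = (-2 : k) • sm k (psiS k y y') := br_am_am k y y'
@[simp] theorem lie_dz_dz : ⁅dz k D, dz k E⁆ = dz k (commI k D E) := br_dz_dz k D E
@[simp] theorem lie_dz_ap : ⁅dz k D, ap k x⁆ = ap k ((D : Module.End k A) x) := br_dz_ap k x D
@[simp] theorem lie_ap_dz : ⁅ap k x, dz k D⁆ = -ap k ((D : Module.End k A) x) := br_ap_dz k x D
@[simp] theorem lie_dz_am : ⁅dz k D, am k y⁆ = am k (eps k D y) := br_dz_am k y D
@[simp] theorem lie_am_dz : ⁅am k y, dz k D⁆ = -am k (eps k D y) := br_am_dz k y D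
@[simp] theorem lie_dz_sp : ⁅dz k D, sp k s⁆ = sp k (deltaS k D s) := br_dz_sp k s D
@[simp] theorem lie_sp_dz : ⁅sp k s, dz k D⁆ = -sp k (deltaS k D s) := by
  rw [← lie_skew, lie_dz_sp]
/-- `ad ζ` is the grading derivation. -/
theorem lie_ze (P : TKK k A) : ⁅ze k A, P⁆ = (-2 : k) • sm k (csm k P) - am k (cam k P)
    + ap k (cap k P) + (2 : k) • sp k (csp k P) := by
  refine (br_zeta k (A := A) P).trans ?_
  unfold sm am ap sp smK amK apK spK csm cam cap csp
  refine Prod.ext ?_ (Prod.ext ?_ (Prod.ext ?_ (Prod.ext ?_ ?_)))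
  · change _ = (-2 : k) • P.1 - 0 + 0 + (2 : k) • 0; simp
  · change _ = (-2 : k) • 0 - P.2.1 + 0 + (2 : k) • 0; simp
  · change _ = (-2 : k) • 0 - 0 + 0 + (2 : k) • 0; simp
  · change _ = (-2 : k) • 0 - 0 + P.2.2.2.1 + (2 : k) • 0; simp
  · change _ = (-2 : k) • 0 - 0 + 0 + (2 : k) • P.2.2.2.2; simp

@[simp] theorem lie_ze_sm : ⁅ze k A, sm k t⁆ = (-2 : k) • sm k t := by simp [lie_ze]
@[simp] theorem lie_ze_am : ⁅ze k A, am k y⁆ = -am k y := by simp [lie_ze]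
@[simp] theorem lie_ze_dz : ⁅ze k A, dz k D⁆ = 0 := by simp [lie_ze]
@[simp] theorem lie_ze_ap : ⁅ze k A, ap k x⁆ = ap k x := by simp [lie_ze]
@[simp] theorem lie_ze_sp : ⁅ze k A, sp k s⁆ = (2 : k) • sp k s := by simp [lie_ze]
@[simp] theorem lie_sm_ze : ⁅sm k t, ze k A⁆ = (2 : k) • sm k t := by
  rw [← lie_skew, lie_ze_sm]; module
@[simp] theorem lie_am_ze : ⁅am k y, ze k A⁆ = am k y := by rw [← lie_skew, lie_ze_am]; module
@[simp] theorem lie_ap_ze : ⁅ap k x, ze k A⁆ = -ap k x := by rw [← lie_skew, lie_ze_ap]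
@[simp] theorem lie_sp_ze : ⁅sp k s, ze k A⁆ = (-2 : k) • sp k s := by
  rw [← lie_skew, lie_ze_sp]; module

end Rules

end

section

variable {k : Type*} {A : Type*} [Field k] [NonAssocRing A] [StarRing A] [Module k A]
  [SMulCommClass k A A] [IsScalarTower k A A]

/-! ### Conjugate inverses and the operators `q_x` -/

theorem VI_of_isConjInv {x v : A} (h : IsConjInv k x v) : VI k x v = VI k 1 1 :=
  Subtype.ext (h.trans (V_one_one k).symm)

theorem isConjInv_conjInv (hdiv : IsDivision k A) {x : A} (hx : x ≠ 0) :
    IsConjInv k x (conjInv k x) := by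
  rw [conjInv, dif_pos (hdiv x hx)]
  exact (hdiv x hx).choose_spec

variable [StructurableAlgebra k A]

theorem IsConjInv.symm {x v : A} (h : IsConjInv k x v) : IsConjInv k v x := by
  have h1 := eps_V k x v
  rw [show V k x v = 1 from h, ← V_one_one (k := k) (A := A), eps_V, V_one_one] at h1
  exact (neg_injective h1).symm

variable (k) in
/-- `q_x` as a map from `S` to `S`. -/
def qS (x : A) (s : skew k A) : skew k A := (6 : k)⁻¹ • psiS k x (U k x (s * x))

theorem qS_eq_zero {x : A} {s : skew k A} (h : s * x = 0) : qS k x s = 0 := by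
  have hV : V k x 0 = 0 := congrArg Subtype.val (VI_zero_right k x)
  rw [qS, h, U, hV, LinearMap.zero_apply, psiS_zero_right, smul_zero]

/-- Skew elements whose left multiplications are inverse up to sign are conjugate inverse. -/
theorem isConjInv_of_mul_mul {a b : skew k A} (h : ∀ z : A, (a : A) * (b * z) = -z) :
    IsConjInv k (a : A) b := by
  have e := two_smul_L_mul_L k a.2 b.2
  have e1 : LinearMap.mulLeft k (a : A) * LinearMap.mulLeft k (b : A) = -1 := LinearMap.ext h
  have e2 : (a : A) * b = -1 := by simpa using h 1
  have e3 : V k (-1 : A) 1 = -1 := by ext z; simp [V_apply]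
  rw [e1, e2, e3] at e
  have : V k (a : A) b = (2 : k) • (1 : Module.End k A) - 1 := by
    linear_combination (norm := module) e
  rw [IsConjInv, this]
  module

variable [Fact (IsAlgebraic k A)]

theorem ad_ap_sm2 (x : A) (t : skew k A) :
    ⁅ap k x, ⁅ap k x, sm k t⁆⁆ = (2 : k) • dz k (VI k x (t * x)) := by
  simp

theorem ad_ap_sm3 (x : A) (t : skew k A) :
    ⁅ap k x, ⁅ap k x, ⁅ap k x, sm k t⁆⁆⁆ = (-2 : k) • ap k (U k x (t * x)) := by
  rw [ad_ap_sm2, lie_smul, lie_ap_dz]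
  simp [VI, U]

theorem ad_ap_sm4 (x : A) (t : skew k A) :
    ⁅ap k x, ⁅ap k x, ⁅ap k x, ⁅ap k x, sm k t⁆⁆⁆⁆ = (24 : k) • sp k (qS k x t) := by
  have h2 := StructurableAlgebra.two_ne_zero (k := k) A
  have h3 := StructurableAlgebra.three_ne_zero (k := k) A
  have h6 : (6 : k) ≠ 0 := by
    rw [show (6 : k) = 2 * 3 by norm_num]; exact mul_ne_zero h2 h3
  rw [ad_ap_sm3, lie_smul, lie_ap_ap, smul_smul, qS, map_smul, smul_smul]
  congr 1
  field_simp
  norm_num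

theorem ad_am_sp2 (y : A) (s : skew k A) :
    ⁅am k y, ⁅am k y, sp k s⁆⁆ = (-2 : k) • dz k (VI k (s * y) y) := by
  simp

theorem ad_am_sp3 (y : A) (s : skew k A) :
    ⁅am k y, ⁅am k y, ⁅am k y, sp k s⁆⁆⁆ = (-2 : k) • am k (U k y (s * y)) := by
  rw [ad_am_sp2, lie_smul, lie_am_dz]
  simp [VI, U, eps_V]

theorem ad_am_sp4 (y : A) (s : skew k A) :
    ⁅am k y, ⁅am k y, ⁅am k y, ⁅am k y, sp k s⁆⁆⁆⁆ = (24 : k) • sm k (qS k y s) := by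
  have h2 := StructurableAlgebra.two_ne_zero (k := k) A
  have h3 := StructurableAlgebra.three_ne_zero (k := k) A
  have h6 : (6 : k) ≠ 0 := by
    rw [show (6 : k) = 2 * 3 by norm_num]; exact mul_ne_zero h2 h3
  rw [ad_am_sp3, lie_smul, lie_am_am, smul_smul, qS, map_smul, smul_smul]
  congr 1
  field_simp
  norm_num

section Sl2

variable {x v : A} (h : IsConjInv k x v)
include h

theorem lie_ap_am_inv : ⁅ap k x, am k v⁆ = (-2 : k) • ze k A := by
  rw [lie_ap_am, VI_of_isConjInv h, ze_eq]

theorem lie_am_ap_inv : ⁅am k v, ap k x⁆ = (2 : k) • ze k A := by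
  rw [lie_am_ap, VI_of_isConjInv h, ze_eq]

theorem am_ap_sm1 (t : skew k A) : ⁅am k v, ⁅ap k x, sm k t⁆⁆ = (-4 : k) • sm k t := by
  rw [leibniz_lie, lie_am_ap_inv h, smul_lie, lie_ze_sm, lie_am_sm, lie_zero]
  module

theorem am_ap_sm2 (t : skew k A) :
    ⁅am k v, ⁅ap k x, ⁅ap k x, sm k t⁆⁆⁆ = (-6 : k) • ⁅ap k x, sm k t⁆ := by
  rw [leibniz_lie, lie_am_ap_inv h, am_ap_sm1 h, lie_smul, smul_lie, lie_ap_sm, lie_neg, lie_ze_am]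
  module

theorem am_ap_sm3 (t : skew k A) : ⁅am k v, ⁅ap k x, ⁅ap k x, ⁅ap k x, sm k t⁆⁆⁆⁆ =
    (-6 : k) • ⁅ap k x, ⁅ap k x, sm k t⁆⁆ := by
  rw [leibniz_lie, lie_am_ap_inv h, am_ap_sm2 h, lie_smul, smul_lie, ad_ap_sm2, lie_smul,
    lie_ze_dz]
  module

theorem am_ap_sm4 (t : skew k A) : ⁅am k v, ⁅ap k x, ⁅ap k x, ⁅ap k x, ⁅ap k x, sm k t⁆⁆⁆⁆⁆ =
    (-4 : k) • ⁅ap k x, ⁅ap k x, ⁅ap k x, sm k t⁆⁆⁆ := by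
  rw [leibniz_lie, lie_am_ap_inv h, am_ap_sm3 h, lie_smul, smul_lie, ad_ap_sm3, lie_smul,
    lie_ze_ap]
  module

/-- `q_{x̂}` is the inverse of `q_x`: on the lowest weight vector of the five-dimensional
`𝔰𝔩₂`-module, `f⁴ e⁴` is `(4!)²`. -/
theorem qS_qS (t : skew k A) : qS k v (qS k x t) = t := by
  have h24 := twentyfour_ne_zero k A
  have e : ⁅am k v, ⁅am k v, ⁅am k v, ⁅am k v, (24 : k) • sp k (qS k x t)⁆⁆⁆⁆
      = (24 : k) • (24 : k) • sm k (qS k v (qS k x t)) := by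
    simp only [lie_smul, ad_am_sp4]
  rw [← ad_ap_sm4] at e
  simp only [lie_smul, am_ap_sm4 h, am_ap_sm3 h, am_ap_sm2 h, am_ap_sm1 h, smul_smul] at e
  have e' : (24 * 24 : k) • sm k t = (24 * 24 : k) • sm k (qS k v (qS k x t)) := by
    rw [← e]; congr 1; norm_num
  exact (sm_injective k ((smul_right_injective _ (mul_ne_zero h24 h24)) e')).symm

theorem qS_injective : Function.Injective (qS k x) := Function.LeftInverse.injective (qS_qS h)

/-- If `V_{x,w} = 0`, then `a = ψ(x̂, w)` satisfies `[x₊, a₋] = -w₋` and thus `q_x(a) = 0`. As `q_x`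
is injective, `a = 0` and `w = 0`. -/
theorem eq_zero_of_V_eq_zero {w : A} (hw : V k x w = 0) : w = 0 := by
  have h2 := StructurableAlgebra.two_ne_zero (k := k) A
  have hw' : VI k x w = 0 := Subtype.ext hw
  have e1 : ⁅ap k x, sm k (psiS k v w)⁆ = -am k w := by
    have : ⁅ap k x, ⁅am k v, am k w⁆⁆ = (2 : k) • am k w := by
      rw [leibniz_lie, lie_ap_am_inv h, lie_ap_am, hw', map_zero, smul_zero, lie_zero, smul_lie,
        lie_ze_am]
      module
    rw [lie_am_am, lie_smul] at this
    refine smul_right_injective _ h2 ?_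
    change (2 : k) • _ = (2 : k) • _
    rw [smul_neg, ← this]; module
  have e2 : qS k x (psiS k v w) = 0 := by
    have := ad_ap_sm3 x (psiS k v w)
    rw [e1, lie_neg, lie_ap_am, hw'] at this
    have hU : U k x (psiS k v w * x) = 0 := by
      refine ap_injective k (smul_right_injective _ (neg_ne_zero.mpr h2) ?_)
      change (-2 : k) • _ = (-2 : k) • _
      rw [← this]; simp
    rw [qS, hU, psiS_zero_right, smul_zero]
  have e3 : psiS k v w = 0 := qS_injective h (e2.trans (qS_eq_zero (zero_mul x)).symm)
  rw [e3, map_zero, lie_zero] at e1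
  exact am_injective k (by rw [map_zero, ← neg_eq_zero, ← e1])

theorem IsConjInv.unique {v' : A} (h' : IsConjInv k x v') : v' = v := by
  refine sub_eq_zero.mp (eq_zero_of_V_eq_zero h ?_)
  have e := congrArg (Subtype.val) (VI_add_right k x (v' - v) v)
  rw [sub_add_cancel] at e
  change V k x v' = V k x (v' - v) + V k x v at e
  rw [show V k x v' = 1 from h', show V k x v = 1 from h] at e
  exact left_eq_add.mp (by rw [add_comm]; exact e)

theorem conjInv_eq : conjInv k x = v := by
  have hex : ∃ v, IsConjInv k x v := ⟨v, h⟩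
  rw [conjInv, dif_pos hex]
  exact h.unique hex.choose_spec

end Sl2

/-! ### Inverses of skew elements -/

/-- The Jacobi identity for `s₊`, `y₋`, `z₋`. -/
theorem V_mul_left_sub (s : skew k A) (y z : A) :
    VI k (s * y) z - VI k (s * z) y = LL k s (psiS k y z) := by
  have h2 := StructurableAlgebra.two_ne_zero (k := k) A
  have e := leibniz_lie (sp k s) (am k y) (am k z)
  simp only [lie_am_am, lie_smul, lie_sp_sm, lie_sp_am, lie_ap_am, lie_am_ap] at e
  refine dz_injective k (smul_right_injective _ h2 ?_)
  change (2 : k) • _ = (2 : k) • _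
  rw [map_sub]
  linear_combination (norm := module) e

/-- `L_s` is injective in a division algebra: if `s z = 0` with `z ≠ 0`, then `q_z(s) = 0`. -/
theorem mul_left_injective_skew (hdiv : IsDivision k A) {s : skew k A} (hs : s ≠ 0) {z : A}
    (hz : (s : A) * z = 0) : z = 0 := by
  by_contra hne
  refine hs (qS_injective (isConjInv_conjInv hdiv hne) ?_)
  rw [qS_eq_zero hz, qS_eq_zero (zero_mul z)]

/-- The Jacobi identity for `a₊`, `b₋`, `z₋`. -/
theorem eps_LL (a b : skew k A) (z : A) :
    eps k (LL k a b : instrl k A) z = -((b : A) * (a * z)) := by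
  have e := leibniz_lie (sp k a) (sm k b) (am k z)
  rw [lie_sm_am, lie_zero, lie_sp_sm, lie_sp_am, lie_dz_am, lie_sm_ap, ← map_add] at e
  exact eq_neg_of_add_eq_zero_left (am_injective k ((map_zero _).trans e)).symm

/-- The operator identity `L_{s (t s)} = L_s L_t L_s` for skew elements. -/
theorem mul_mul_mul_skew (s t : skew k A) (y : A) :
    (s : A) * (t * s) * y = (s : A) * (t * (s * y)) := by
  have h2 := StructurableAlgebra.two_ne_zero (k := k) A
  have e1 : ⁅sp k s, ⁅sp k s, sm k t⁆⁆ = -sp k (deltaS k (LL k s t) s) := by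
    rw [lie_sp_sm, ← lie_skew, lie_dz_sp]
  have e2 : (deltaS k (LL k s t) s : A) = (2 : k) • ((s : A) * (t * s)) := by
    change (s : A) * (t * s) + s * star ((s : A) * (t * 1)) = _
    rw [mul_one, star_mul, show star (s : A) = -s from s.2, show star (t : A) = -t from t.2]
    rw [neg_mul_neg, two_smul]
  have e3 := leibniz_lie (sp k s) ⁅sp k s, sm k t⁆ (am k y)
  rw [e1, neg_lie, lie_sp_am, lie_sp_am, lie_sp_sm, e2, lie_dz_am, lie_dz_ap, lie_sp_am] at e3
  have e6 : ((LL k s t : instrl k A) : Module.End k A) ((s : A) * y) = s * (t * (s * y)) := rfl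
  rw [eps_LL, e6, ← map_neg, ← map_add] at e3
  have e7 := ap_injective k e3
  refine smul_right_injective _ h2 ?_
  change (2 : k) • _ = (2 : k) • _
  rw [smul_mul_assoc, mul_neg] at e7
  linear_combination (norm := module) e7

/-- In a division algebra, the conjugate inverse of a skew element `s` is skew, and is the element
`-s⁻¹` in the sense of left multiplications. -/
theorem exists_skew_inverse (hdiv : IsDivision k A) {s : skew k A} (hs : s ≠ 0) :
    ∃ v : skew k A, (v : A) = conjInv k (s : A) ∧ (∀ z : A, (s : A) * (v * z) = -z) ∧
      ∀ z : A, (v : A) * (s * z) = -z := by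
  have h2 := StructurableAlgebra.two_ne_zero (k := k) A
  have hss : star (s : A) = -s := s.2
  have : Module.Finite k A := StructurableAlgebra.finite
  have hinj : Function.Injective (LinearMap.mulLeft k (s : A)) :=
    (injective_iff_map_eq_zero _).mpr fun z hz => mul_left_injective_skew hdiv hs hz
  obtain ⟨v, hv⟩ := LinearMap.injective_iff_surjective.mp hinj (-1)
  change (s : A) * v = -1 at hv
  -- from `[s, s, v] = 0 = [s, v, s]`
  have hvs : v * s = -1 := by
    apply hinj
    change (s : A) * (v * s) = s * (-1)
    have a1 := skew_alt_left k s.2 (s : A) v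
    have a2 := skew_alt_right k s.2 (s : A) v
    rw [hv] at a1 a2
    have b : (2 : k) • ((s : A) * (v * s) + s) = 0 := by
      simp only [mul_neg, neg_mul, one_mul, mul_one] at *
      linear_combination (norm := module) (2 : k) • a2 - a1
    have := (smul_eq_zero.mp b).resolve_left h2
    rw [mul_neg, mul_one]
    exact eq_neg_of_add_eq_zero_left this
  have hsv : star v = -v := by
    have h := congrArg star hvs
    rw [star_mul, hss, star_neg, star_one, neg_mul, neg_inj] at h
    apply hinj
    change (s : A) * star v = s * -v
    rw [h, mul_neg, hv, neg_neg]
  have hvz : ∀ z : A, v * (s * z) = -z := by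
    intro z
    apply hinj
    change (s : A) * (v * (s * z)) = s * -z
    have := mul_mul_mul_skew s ⟨v, hsv⟩ z
    rw [← this, hvs]
    simp
  have hsvz : ∀ z : A, (s : A) * (v * z) = -z := by
    intro z
    obtain ⟨w, rfl⟩ := LinearMap.injective_iff_surjective.mp hinj z
    change (s : A) * (v * (s * w)) = -(s * w)
    rw [hvz, mul_neg]
  exact ⟨⟨v, hsv⟩, (conjInv_eq (isConjInv_of_mul_mul (a := s) (b := ⟨v, hsv⟩) hsvz)).symm, hsvz,
    hvz⟩

end

section

variable {k : Type*} {A : Type*} [Field k] [NonAssocRing A] [StarRing A] [Module k A]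
  [SMulCommClass k A A] [IsScalarTower k A A]
variable [StructurableAlgebra k A]

/-! ### Exponentials -/

variable (k) in
/-- The exponential of `ad(P)`, as an endomorphism of `𝔤`. -/
def ex (P : TKK k A) : TKK k A →ₗ[k] TKK k A := expAd k (-2) (A := A) P

variable (k) in
/-- `e₊(x, s)` as an endomorphism of `𝔤`. -/
def eP (x : A) (s : skew k A) : TKK k A →ₗ[k] TKK k A := ex k (ap k x + sp k s)

variable (k) in
/-- `e₋(y, t)` as an endomorphism of `𝔤`. -/
def eM (y : A) (t : skew k A) : TKK k A →ₗ[k] TKK k A := ex k (am k y + sm k t)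

variable (k A) in
/-- The elements of `𝔤` of degree `n`. -/
def deg (n : ℤ) : Submodule k (TKK k A) := gr k n

theorem sm_mem_deg (t : skew k A) : sm k t ∈ deg k A (-2) := smK_mem k t
theorem am_mem_deg (y : A) : am k y ∈ deg k A (-1) := amK_mem k y
theorem dz_mem_deg (D : instrl k A) : dz k D ∈ deg k A 0 := dzK_mem k D
theorem ap_mem_deg (x : A) : ap k x ∈ deg k A 1 := apK_mem k x
theorem sp_mem_deg (s : skew k A) : sp k s ∈ deg k A 2 := spK_mem k s

theorem deg_eq_zero {n : ℤ} {P : TKK k A} (hP : P ∈ deg k A n) (hn : 2 < n ∨ n < -2) : P = 0 :=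
  eq_zero_of_mem k hP hn

variable (k A) in
/-- The span of the homogeneous elements of degrees at least `n`, for `σ = 1`, or at most `-n`, for
`σ = -1`. -/
def fil (σ n : ℤ) : Submodule k (TKK k A) :=
  ⨆ (m : ℤ) (_ : n ≤ σ * m), deg k A m

theorem mem_fil {σ n m : ℤ} (h : n ≤ σ * m) {P : TKK k A} (hP : P ∈ deg k A m) :
    P ∈ fil k A σ n :=
  Submodule.mem_iSup_of_mem m (Submodule.mem_iSup_of_mem h hP)

theorem fil_le {σ n : ℤ} {N : Submodule k (TKK k A)}
    (h : ∀ m : ℤ, n ≤ σ * m → ∀ P : TKK k A, P ∈ deg k A m → P ∈ N) : fil k A σ n ≤ N :=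
  iSup_le fun m => iSup_le fun hm => fun P hP => h m hm P hP

theorem mem_fil_neg_two {σ : ℤ} (hσ : σ = 1 ∨ σ = -1) (Q : TKK k A) : Q ∈ fil k A σ (-2) := by
  have hg : ∀ n : ℤ, -2 ≤ n → n ≤ 2 → -2 ≤ σ * n := by
    intro n hn hn'
    rcases hσ with h | h <;> rw [h] <;> omega
  rw [decompose k Q]
  refine add_mem (add_mem (add_mem (add_mem ?_ ?_) ?_) ?_) ?_
  · exact mem_fil (hg (-2) le_rfl (by norm_num)) (sm_mem_deg _)
  · exact mem_fil (hg (-1) (by norm_num) (by norm_num)) (am_mem_deg _)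
  · exact mem_fil (hg 0 (by norm_num) (by norm_num)) (dz_mem_deg _)
  · exact mem_fil (hg 1 (by norm_num) (by norm_num)) (ap_mem_deg _)
  · exact mem_fil (hg 2 (by norm_num) le_rfl) (sp_mem_deg _)

theorem eq_zero_of_mem_fil_three {σ : ℤ} (hσ : σ = 1 ∨ σ = -1) {Q : TKK k A}
    (hQ : Q ∈ fil k A σ 3) : Q = 0 := by
  have final : fil k A σ 3 ≤ ⊥ := by
    refine fil_le fun m hm P hP => ?_
    refine (Submodule.mem_bot k).mpr (deg_eq_zero hP ?_)
    rcases hσ with h | h <;> rw [h] at hm <;> omega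
  exact (Submodule.mem_bot k).mp (final hQ)

theorem LL_coe (s t : skew k A) (z : A) :
    ((LL k s t : instrl k A) : Module.End k A) z = s * (t * z) := rfl

variable [Fact (IsAlgebraic k A)]

theorem lie_mem_deg {i j : ℤ} {P Q : TKK k A} (hP : P ∈ deg k A i) (hQ : Q ∈ deg k A j) :
    ⁅P, Q⁆ ∈ deg k A (i + j) := br_mem k hP hQ

theorem ex_apply (P Q : TKK k A) : ex k P Q =
    Q + ⁅P, Q⁆ + (2 : k)⁻¹ • ⁅P, ⁅P, Q⁆⁆ + (6 : k)⁻¹ • ⁅P, ⁅P, ⁅P, Q⁆⁆⁆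
      + (24 : k)⁻¹ • ⁅P, ⁅P, ⁅P, ⁅P, Q⁆⁆⁆⁆ := expAd_apply (A := A) P Q

theorem ex_lie {P : TKK k A} (h : IsLieAut k (-2) (expAd k (-2) (A := A) P)) (Q R : TKK k A) :
    ex k P ⁅Q, R⁆ = ⁅ex k P Q, ex k P R⁆ := by
  have h1 := h.map_br Q R
  rw [lie_def, lie_def]
  unfold ex
  exact h1

theorem eP_lie (x : A) (s : skew k A) (P Q : TKK k A) :
    eP k x s ⁅P, Q⁆ = ⁅eP k x s P, eP k x s Q⁆ := by
  have h := isLieAut_ePlus (Fact.out : IsAlgebraic k A) (x, s)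
  rw [ePlus, toPlus_eq] at h
  exact ex_lie (P := ap k x + sp k s) h P Q

theorem eM_lie (y : A) (t : skew k A) (P Q : TKK k A) :
    eM k y t ⁅P, Q⁆ = ⁅eM k y t P, eM k y t Q⁆ := by
  have h := isLieAut_eMinus (Fact.out : IsAlgebraic k A) (y, t)
  rw [eMinus, toMinus_eq] at h
  exact ex_lie (P := am k y + sm k t) h P Q

/-- The truncated exponentials of `P` and `-P` are inverse if five brackets with `P` vanish. -/
theorem exp_neg_exp {P : TKK k A} (hP : ∀ Q : TKK k A, ⁅P, ⁅P, ⁅P, ⁅P, ⁅P, Q⁆⁆⁆⁆⁆ = 0)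
    (Q : TKK k A) : ex k (-P) (ex k P Q) = Q := by
  have h2 := StructurableAlgebra.two_ne_zero (k := k) A
  have h3 := StructurableAlgebra.three_ne_zero (k := k) A
  have h6 := inv_six k
  have h24 := inv_twentyfour k
  rw [ex_apply, ex_apply]
  simp only [neg_lie, lie_neg, lie_add, lie_smul, hP, lie_zero, h6, h24]
  match_scalars <;> (try field_simp) <;> ring

theorem lie_mem_fil {σ : ℤ} {P₁ P₂ : TKK k A} (h1 : P₁ ∈ deg k A σ)
    (h2 : P₂ ∈ deg k A (2 * σ)) (hσ : σ * σ = 1) (n : ℤ) {Q : TKK k A}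
    (hQ : Q ∈ fil k A σ n) : ⁅P₁ + P₂, Q⁆ ∈ fil k A σ (n + 1) := by
  suffices h : fil k A σ n ≤ (fil k A σ (n + 1)).comap
    (LieAlgebra.ad k (TKK k A) (P₁ + P₂)) from h hQ
  refine fil_le fun m hm P hP => ?_
  change ⁅P₁ + P₂, P⁆ ∈ fil k A σ (n + 1)
  have m1 : ⁅P₁, P⁆ ∈ deg k A (σ + m) := lie_mem_deg h1 hP
  have m2 : ⁅P₂, P⁆ ∈ deg k A (2 * σ + m) := lie_mem_deg h2 hP
  rw [add_lie]
  refine add_mem (mem_fil ?_ m1) (mem_fil ?_ m2)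
  · rw [mul_add]; omega
  · rw [mul_add, mul_left_comm]; omega

theorem lie_pow_five {σ : ℤ} {P₁ P₂ : TKK k A} (h1 : P₁ ∈ deg k A σ)
    (h2 : P₂ ∈ deg k A (2 * σ)) (hσ : σ * σ = 1) (Q : TKK k A) :
    ⁅P₁ + P₂, ⁅P₁ + P₂, ⁅P₁ + P₂, ⁅P₁ + P₂, ⁅P₁ + P₂, Q⁆⁆⁆⁆⁆ = 0 := by
  have hσ' : σ = 1 ∨ σ = -1 := mul_self_eq_one_iff.mp hσ
  have step := fun n Q hQ => lie_mem_fil h1 h2 hσ n (Q := Q) hQ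
  have s0 := step _ _ (mem_fil_neg_two hσ' Q)
  have s1 := step _ _ s0
  have s2 := step _ _ s1
  have s3 := step _ _ s2
  have s4 := step _ _ s3
  exact eq_zero_of_mem_fil_three hσ' s4

theorem eP_neg_eP (x : A) (s : skew k A) (Q : TKK k A) : eP k (-x) (-s) (eP k x s Q) = Q := by
  have h := exp_neg_exp (lie_pow_five (σ := 1) (ap_mem_deg x) (sp_mem_deg s) (by norm_num)) Q
  have e : -(ap k x + sp k s) = ap k (-x) + sp k (-s) := by rw [map_neg, map_neg, neg_add]
  rw [e] at h
  exact h

theorem eM_neg_eM (y : A) (t : skew k A) (Q : TKK k A) : eM k (-y) (-t) (eM k y t Q) = Q := by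
  have h := exp_neg_exp (lie_pow_five (σ := -1) (am_mem_deg y) (sm_mem_deg t) (by norm_num)) Q
  have e : -(am k y + sm k t) = am k (-y) + sm k (-t) := by rw [map_neg, map_neg, neg_add]
  rw [e] at h
  exact h

theorem eP_eP_neg (x : A) (s : skew k A) (Q : TKK k A) : eP k x s (eP k (-x) (-s) Q) = Q := by
  simpa using eP_neg_eP (-x) (-s) Q

theorem eM_eM_neg (y : A) (t : skew k A) (Q : TKK k A) : eM k y t (eM k (-y) (-t) Q) = Q := by
  simpa using eM_neg_eM (-y) (-t) Q

theorem eM_ze (y : A) (t : skew k A) : eM k y t (ze k A) = ze k A + am k y + (2 : k) • sm k t := by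
  rw [eM, ex_apply]
  simp
  abel

theorem eP_ze (x : A) (s : skew k A) :
    eP k x s (ze k A) = ze k A - ap k x - (2 : k) • sp k s := by
  rw [eP, ex_apply]
  simp
  module

theorem eM_am_sm (y : A) (t : skew k A) (a : A) (b : skew k A) :
    eM k y t (am k a + sm k b) = am k a + sm k (b - (2 : k) • psiS k y a) := by
  rw [eM, ex_apply]
  simp
  module

theorem lie_sp_lie_ap (x : A) (s : skew k A) (P : TKK k A) :
    ⁅sp k s, ⁅ap k x, P⁆⁆ = ⁅ap k x, ⁅sp k s, P⁆⁆ := by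
  rw [leibniz_lie, lie_sp_ap, zero_lie, zero_add]

theorem eP_am (x : A) (s : skew k A) (z : A) : eP k x s (am k z) =
    am k z + ⁅ap k x, am k z⁆ + ⁅sp k s, am k z⁆ + (2 : k)⁻¹ • ⁅ap k x, ⁅ap k x, am k z⁆⁆
      + ⁅ap k x, ⁅sp k s, am k z⁆⁆ + (6 : k)⁻¹ • ⁅ap k x, ⁅ap k x, ⁅ap k x, am k z⁆⁆⁆ := by
  have h2 := StructurableAlgebra.two_ne_zero (k := k) A
  have e1 : ⁅ap k x + sp k s, am k z⁆ = ⁅ap k x, am k z⁆ + ⁅sp k s, am k z⁆ := add_lie _ _ _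
  have e2 : ⁅ap k x + sp k s, ⁅ap k x, am k z⁆ + ⁅sp k s, am k z⁆⁆ =
      ⁅ap k x, ⁅ap k x, am k z⁆⁆ + (2 : k) • ⁅ap k x, ⁅sp k s, am k z⁆⁆ := by
    rw [add_lie, lie_add, lie_add, lie_sp_lie_ap, lie_sp_am, lie_sp_ap]; module
  have e3 : ⁅ap k x + sp k s, ⁅ap k x, ⁅ap k x, am k z⁆⁆ + (2 : k) • ⁅ap k x, ⁅sp k s, am k z⁆⁆⁆ =
      ⁅ap k x, ⁅ap k x, ⁅ap k x, am k z⁆⁆⁆ := by simp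
  have e4 : ⁅ap k x + sp k s, ⁅ap k x, ⁅ap k x, ⁅ap k x, am k z⁆⁆⁆⁆ = 0 := by simp
  rw [eP, ex_apply, e1, e2, e3, e4]
  match_scalars <;> field_simp

theorem eP_sm (x : A) (s t : skew k A) : eP k x s (sm k t) =
    sm k t + ⁅ap k x, sm k t⁆ + ⁅sp k s, sm k t⁆ + (2 : k)⁻¹ • ⁅ap k x, ⁅ap k x, sm k t⁆⁆
      + ⁅ap k x, ⁅sp k s, sm k t⁆⁆ + (6 : k)⁻¹ • ⁅ap k x, ⁅ap k x, ⁅ap k x, sm k t⁆⁆⁆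
      + (2 : k)⁻¹ • ⁅sp k s, ⁅sp k s, sm k t⁆⁆
      + (2 : k)⁻¹ • ⁅ap k x, ⁅ap k x, ⁅sp k s, sm k t⁆⁆⁆
      + (24 : k)⁻¹ • ⁅ap k x, ⁅ap k x, ⁅ap k x, ⁅ap k x, sm k t⁆⁆⁆⁆ := by
  have h2 := StructurableAlgebra.two_ne_zero (k := k) A
  have h3 := StructurableAlgebra.three_ne_zero (k := k) A
  have h6 := inv_six k
  have e1 : ⁅ap k x + sp k s, sm k t⁆ = ⁅ap k x, sm k t⁆ + ⁅sp k s, sm k t⁆ := add_lie _ _ _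
  have e2 : ⁅ap k x + sp k s, ⁅ap k x, sm k t⁆ + ⁅sp k s, sm k t⁆⁆ =
      ⁅ap k x, ⁅ap k x, sm k t⁆⁆ + (2 : k) • ⁅ap k x, ⁅sp k s, sm k t⁆⁆
        + ⁅sp k s, ⁅sp k s, sm k t⁆⁆ := by
    rw [add_lie, lie_add, lie_add, lie_sp_lie_ap]; module
  have e3 : ⁅ap k x + sp k s, ⁅ap k x, ⁅ap k x, sm k t⁆⁆ + (2 : k) • ⁅ap k x, ⁅sp k s, sm k t⁆⁆
        + ⁅sp k s, ⁅sp k s, sm k t⁆⁆⁆ =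
      ⁅ap k x, ⁅ap k x, ⁅ap k x, sm k t⁆⁆⁆
        + (3 : k) • ⁅ap k x, ⁅ap k x, ⁅sp k s, sm k t⁆⁆⁆ := by
    have z1 : ⁅sp k s, ⁅sp k s, ⁅sp k s, sm k t⁆⁆⁆ = 0 := by simp
    have z2 : ⁅ap k x, ⁅sp k s, ⁅sp k s, sm k t⁆⁆⁆ = 0 := by simp
    simp only [add_lie, lie_add, lie_smul, lie_sp_lie_ap, z1, z2]
    module
  have e4 : ⁅ap k x + sp k s, ⁅ap k x, ⁅ap k x, ⁅ap k x, sm k t⁆⁆⁆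
        + (3 : k) • ⁅ap k x, ⁅ap k x, ⁅sp k s, sm k t⁆⁆⁆⁆ =
      ⁅ap k x, ⁅ap k x, ⁅ap k x, ⁅ap k x, sm k t⁆⁆⁆⁆ := by simp
  rw [eP, ex_apply, e1, e2, e3, e4, h6]
  match_scalars <;> field_simp

end

section

variable {k : Type*} {A : Type*} [Field k] [NonAssocRing A] [StarRing A] [Module k A]
  [SMulCommClass k A A] [IsScalarTower k A A]
variable [StructurableAlgebra k A]

/-! ### Automorphisms that reverse the grading -/

/-- The identity map from `TKK k A` to the underlying vector space `K k A`. -/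
def toK (P : TKK k A) : K k A := P

theorem toK_ex (P Q : TKK k A) : toK (ex k (A := A) P Q) = expAd k (-2) (toK P) (toK Q) :=
  Eq.refl (ex k (A := A) P Q)

theorem toK_eM (y : A) (t : skew k A) (P : TKK k A) :
    toK (eM k y t P) = eMinus k (y, t) (toK P) :=
  (toK_ex (am k y + sm k t) P).trans
    (congrArg (fun X => expAd k (-2) X (toK P)) (toMinus_eq k (y, t)).symm)

theorem toK_eP (x : A) (s : skew k A) (P : TKK k A) :
    toK (eP k x s P) = ePlus k (x, s) (toK P) :=
  (toK_ex (ap k x + sp k s) P).trans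
    (congrArg (fun X => expAd k (-2) X (toK P)) (toPlus_eq k (x, s)).symm)

theorem toK_ze : toK (ze k A) = zeta k A := rfl

theorem toK_neg (P : TKK k A) : toK (-P) = -toK P := rfl

theorem toK_injective : Function.Injective (toK (k := k) (A := A)) := fun _ _ h => h

theorem eM_eP_eM_ze_iff (x y z : A) (s t r : skew k A) :
    eM k y t (eP k x s (eM k z r (ze k A))) = -ze k A ↔
      (eMinus k (y, t) ∘ₗ ePlus k (x, s) ∘ₗ eMinus k (z, r)) (zeta k A) = -zeta k A := by
  rw [← toK_injective.eq_iff, toK_eM, toK_eP, toK_eM, toK_neg, toK_ze, LinearMap.comp_apply,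
    LinearMap.comp_apply]

theorem IsLieAut.comp {c : k} {f g : Module.End k (K k A)} (hf : IsLieAut k c f)
    (hg : IsLieAut k c g) : IsLieAut k c (f ∘ₗ g) := by
  refine ⟨hf.1.comp hg.1, fun P Q => ?_⟩
  rw [LinearMap.comp_apply, hg.2, hf.2]
  rfl

theorem coe_ofBijective {f : Module.End k (K k A)} (hf : Function.Bijective f) :
    ((LinearEquiv.ofBijective f hf : K k A ≃ₗ[k] K k A) : K k A →ₗ[k] K k A) = f :=
  LinearMap.ext fun _ => rfl

theorem coe_mul_equiv (f g : K k A ≃ₗ[k] K k A) :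
    ((f * g : K k A ≃ₗ[k] K k A) : K k A →ₗ[k] K k A) =
    (f : K k A →ₗ[k] K k A) ∘ₗ g := rfl

theorem hasInverses_of_map_zeta (hA : IsAlgebraic k A) {l p r : A × skew k A}
    (h : (eMinus k l ∘ₗ ePlus k p ∘ₗ eMinus k r) (zeta k A) = -zeta k A) :
    HasInverses k p l r := by
  have hl := isLieAut_eMinus hA l
  have hp := isLieAut_ePlus hA p
  have hr := isLieAut_eMinus hA r
  have hc := hl.comp (hp.comp hr)
  have ml : LinearEquiv.ofBijective (eMinus k l) hl.1 ∈ elementaryGroup k A :=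
    Subgroup.subset_closure ⟨l, Or.inr (coe_ofBijective _)⟩
  have mp : LinearEquiv.ofBijective (ePlus k p) hp.1 ∈ elementaryGroup k A :=
    Subgroup.subset_closure ⟨p, Or.inl (coe_ofBijective _)⟩
  have mr : LinearEquiv.ofBijective (eMinus k r) hr.1 ∈ elementaryGroup k A :=
    Subgroup.subset_closure ⟨r, Or.inr (coe_ofBijective _)⟩
  have hcoe : ((LinearEquiv.ofBijective (eMinus k l) hl.1 *
      (LinearEquiv.ofBijective (ePlus k p) hp.1 * LinearEquiv.ofBijective (eMinus k r) hr.1) :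
      K k A ≃ₗ[k] K k A) : K k A →ₗ[k] K k A) = eMinus k l ∘ₗ ePlus k p ∘ₗ eMinus k r := by
    rw [coe_mul_equiv, coe_mul_equiv, coe_ofBijective, coe_ofBijective, coe_ofBijective]
  have m := mul_mem ml (mul_mem mp mr)
  refine ⟨_, ⟨m, ?_, ?_⟩, hcoe⟩
  · rw [hcoe]; exact hc
  · rw [← hcoe] at h; exact h

-- from here on, only the bracket rules and the formulas for the exponentials are used
attribute [irreducible] TKK sm am dz ap sp csm cam cdz cap csp ex eP eM

/-! ### One-invertibility -/

theorem isSolution_of_isConjInv {x v : A} (h : IsConjInv k x v) : IsSolution k x 0 v 0 := by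
  refine ⟨?_, ?_, ?_⟩
  · rw [show V k x v = 1 from h]
    ext z; simp
  · have hV : V k x 0 = 0 := congrArg Subtype.val (VI_zero_right k x)
    simp [U, hV]
  · simp [psi]

theorem isSolution_skew {s s' : skew k A} (hs : ∀ z : A, (s : A) * (s' * z) = -z) :
    IsSolution k 0 s 0 s' := by
  refine ⟨LinearMap.ext fun z => ?_, ?_, ?_⟩
  · change V k 0 0 z = z + (s : A) * (s' * z)
    rw [hs, V_apply]
    simp
  · simp [U]
  · simp [psi]

variable [Fact (IsAlgebraic k A)]

/-- The components of degrees `0` and `1` of this equation are the first two equations of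
`IsSolution`; the component of degree `2` follows by applying `ad(x₊)` and `ad(s₊)` to them and
using the third equation. -/
theorem eP_of_isSolution {x : A} {s : skew k A} {u : A} {t : skew k A}
    (h : IsSolution k x s u t) :
    eP k x s (ze k A + am k (u + t * x) + (2 : k) • sm k t) =
      -ze k A + am k (u - t * x) + (2 : k) • sm k t := by
  obtain ⟨hV, hsu, hpsi⟩ := h
  have h2 := StructurableAlgebra.two_ne_zero (k := k) A
  have h3 := StructurableAlgebra.three_ne_zero (k := k) A
  have h6 := inv_six k
  have h24 := inv_twentyfour k
  have hVI : VI k x u = VI k 1 1 + LL k s t := by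
    refine Subtype.ext ?_
    change V k x u = V k 1 1 + _
    rw [hV, V_one_one]
    rfl
  set z : A := u + t * x with hz
  have hy : am k (u - t * x) = am k z + (2 : k) • ⁅ap k x, sm k t⁆ := by
    rw [lie_ap_sm, hz, map_sub, map_add]; module
  have d0 : ⁅ap k x, am k z⁆ =
      (-2 : k) • ze k A - (2 : k) • ⁅sp k s, sm k t⁆ - ⁅ap k x, ⁅ap k x, sm k t⁆⁆ := by
    rw [lie_ap_am, hz, VI_add_right, hVI, ad_ap_sm2, lie_sp_sm, ze_eq, map_add, map_add]; module
  have d1 : ⁅sp k s, am k z⁆ = -⁅ap k x, ⁅sp k s, sm k t⁆⁆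
      + (6 : k)⁻¹ • ⁅ap k x, ⁅ap k x, ⁅ap k x, sm k t⁆⁆⁆ := by
    rw [lie_sp_am, lie_sp_sm, lie_ap_dz, LL_coe, ad_ap_sm3, hz, mul_add, hsu, map_add, map_neg,
      map_smul, h6]
    match_scalars <;> field_simp
  have d2 : ⁅ap k x, ⁅ap k x, ⁅sp k s, sm k t⁆⁆⁆ = 0 := by
    have : psiS k x (s * (t * x)) = 0 := Subtype.ext hpsi
    rw [lie_sp_sm, lie_ap_dz, LL_coe, lie_neg, lie_ap_ap, this, map_zero, smul_zero, neg_zero]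
  have c2 : ⁅ap k x, ⁅ap k x, am k z⁆⁆ = (2 : k) • ap k x
      - (2 : k) • ⁅ap k x, ⁅sp k s, sm k t⁆⁆ - ⁅ap k x, ⁅ap k x, ⁅ap k x, sm k t⁆⁆⁆ := by
    rw [d0]; simp only [lie_sub, lie_smul, lie_ap_ze]; module
  have c3 : ⁅ap k x, ⁅ap k x, ⁅ap k x, am k z⁆⁆⁆ =
      -⁅ap k x, ⁅ap k x, ⁅ap k x, ⁅ap k x, sm k t⁆⁆⁆⁆ := by
    rw [c2]; simp only [lie_sub, lie_smul, d2, lie_self]; module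
  have c4 : ⁅ap k x, ⁅sp k s, am k z⁆⁆ =
      (6 : k)⁻¹ • ⁅ap k x, ⁅ap k x, ⁅ap k x, ⁅ap k x, sm k t⁆⁆⁆⁆ := by
    rw [d1]; simp only [lie_add, lie_neg, lie_smul, d2]; module
  have c5 : (2 : k) • ⁅sp k s, ⁅sp k s, sm k t⁆⁆ = (4 : k) • sp k s
      - (6 : k)⁻¹ • ⁅ap k x, ⁅ap k x, ⁅ap k x, ⁅ap k x, sm k t⁆⁆⁆⁆ := by
    have e : ⁅sp k s, ⁅ap k x, am k z⁆⁆ =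
        (4 : k) • sp k s - (2 : k) • ⁅sp k s, ⁅sp k s, sm k t⁆⁆ := by
      rw [d0]; simp only [lie_sub, lie_smul, lie_sp_lie_ap, d2, lie_sp_ze]; module
    rw [lie_sp_lie_ap, c4] at e
    rw [e]; module
  rw [map_add, map_add, map_smul, eP_ze, eP_am, eP_sm, hy, h6, h24]
  rw [h6] at d1 c4 c5
  linear_combination (norm := skip) d0 + d1 + (2 : k)⁻¹ • c2 + ((2 : k)⁻¹ * (3 : k)⁻¹) • c3
    + c4 + (2 : k)⁻¹ • c5 + d2
  match_scalars <;> (try field_simp) <;> ring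

theorem eM_eP_eM_of_isSolution {x : A} {s : skew k A} {u : A} {t : skew k A}
    (h : IsSolution k x s u t) :
    eM k (u - t * x) t (eP k x s (eM k (u + t * x) t (ze k A))) = -ze k A := by
  have e : -ze k A + am k (u - t * x) + (2 : k) • sm k t =
      -eM k (-(u - t * x)) (-t) (ze k A) := by
    rw [eM_ze, map_neg, map_neg]; module
  rw [eM_ze, eP_of_isSolution h, e, map_neg, eM_eM_neg]

section Reversing

variable {f : TKK k A →ₗ[k] TKK k A} (hf : ∀ P Q, f ⁅P, Q⁆ = ⁅f P, f Q⁆)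
  (hz : f (ze k A) = -ze k A)
include hf hz

theorem lie_ze_map {a : k} {P : TKK k A} (h : ⁅ze k A, P⁆ = a • P) :
    ⁅ze k A, f P⁆ = -a • f P := by
  have := hf (ze k A) P
  rw [h, hz, map_smul, neg_lie] at this
  rw [neg_smul, this, neg_neg]

theorem map_am_mem (y : A) : f (am k y) = ap k (cap k (f (am k y))) := by
  have h2 := StructurableAlgebra.two_ne_zero (k := k) A
  have h3 := StructurableAlgebra.three_ne_zero (k := k) A
  have e := lie_ze_map hf hz (a := -1) (P := am k y) (by rw [lie_ze_am]; module)
  rw [neg_neg, one_smul, lie_ze] at e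
  have e1 := congrArg (csm k) e
  have e2 := congrArg (cam k) e
  have e3 := congrArg (cdz k) e
  have e5 := congrArg (csp k) e
  simp only [map_add, map_sub, map_smul, csm_sm, csm_am, csm_ap, csm_sp, cam_sm, cam_am, cam_ap,
    cam_sp, cdz_sm, cdz_am, cdz_ap, cdz_sp, csp_sm, csp_am, csp_ap, csp_sp, smul_zero, add_zero,
    sub_zero, zero_sub, zero_add] at e1 e2 e3 e5
  have z1 : csm k (f (am k y)) = 0 := by
    refine (smul_eq_zero.mp (?_ : (3 : k) • csm k (f (am k y)) = 0)).resolve_left h3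
    linear_combination (norm := module) -e1
  have z2 : cam k (f (am k y)) = 0 := by
    refine (smul_eq_zero.mp (?_ : (2 : k) • cam k (f (am k y)) = 0)).resolve_left h2
    linear_combination (norm := module) -e2
  have z5 : csp k (f (am k y)) = 0 := by
    linear_combination (norm := module) e5
  conv_lhs => rw [decompose k (f (am k y))]
  rw [z1, z2, ← e3, z5]
  simp

theorem map_sm_mem (t : skew k A) : f (sm k t) = sp k (csp k (f (sm k t))) := by
  have h2 := StructurableAlgebra.two_ne_zero (k := k) A
  have h3 := StructurableAlgebra.three_ne_zero (k := k) A
  have e := lie_ze_map hf hz (lie_ze_sm k t)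
  rw [neg_neg, lie_ze] at e
  have e1 := congrArg (csm k) e
  have e2 := congrArg (cam k) e
  have e3 := congrArg (cdz k) e
  have e4 := congrArg (cap k) e
  simp only [map_add, map_sub, map_smul, csm_sm, csm_am, csm_ap, csm_sp, cam_sm, cam_am, cam_ap,
    cam_sp, cdz_sm, cdz_am, cdz_ap, cdz_sp, cap_sm, cap_am, cap_ap, cap_sp, smul_zero, add_zero,
    sub_zero, zero_sub, zero_add] at e1 e2 e3 e4
  have z1 : csm k (f (sm k t)) = 0 := by
    refine (smul_eq_zero.mp (?_ : ((2 : k) * 2) • csm k (f (sm k t)) = 0)).resolve_left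
      (mul_ne_zero h2 h2)
    linear_combination (norm := module) -e1
  have z2 : cam k (f (sm k t)) = 0 := by
    refine (smul_eq_zero.mp (?_ : (3 : k) • cam k (f (sm k t)) = 0)).resolve_left h3
    linear_combination (norm := module) -e2
  have z3 : cdz k (f (sm k t)) = 0 := (smul_eq_zero.mp e3.symm).resolve_left h2
  have z4 : cap k (f (sm k t)) = 0 := by
    linear_combination (norm := module) -e4
  conv_lhs => rw [decompose k (f (sm k t))]
  rw [z1, z2, z3, z4]
  simp

end Reversing

/-- The left and right inverses are unique: `e₊(x, s)` maps the difference `w` of `e₋(z, r) ζ` and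
`e₋(z', r') ζ` to an element of `A₋ + S₋`, so that the automorphism `e₋(y, t) e₊(x, s) e₋(z, r)`
maps an element of `A₋ + S₋` into `A₋ + S₋`. As it reverses the grading, `w = 0`. -/
theorem inverses_unique {x : A} {s : skew k A} {y y' z z' : A} {t t' r r' : skew k A}
    (h : eM k y t (eP k x s (eM k z r (ze k A))) = -ze k A)
    (h' : eM k y' t' (eP k x s (eM k z' r' (ze k A))) = -ze k A) :
    (y' = y ∧ t' = t) ∧ z' = z ∧ r' = r := by
  have h2 := StructurableAlgebra.two_ne_zero (k := k) A
  have key : ∀ {y z : A} {t r : skew k A},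
      eM k y t (eP k x s (eM k z r (ze k A))) = -ze k A →
      eP k x s (ze k A + am k z + (2 : k) • sm k r) = -ze k A + am k y + (2 : k) • sm k t := by
    intro y z t r h
    have e := congrArg (eM k (-y) (-t)) h
    rw [eM_neg_eM, map_neg, eM_ze, eM_ze, map_neg, map_neg] at e
    rw [e]; module
  have e : eP k x s (am k (z - z') + sm k ((2 : k) • (r - r'))) =
      am k (y - y') + sm k ((2 : k) • (t - t')) := by
    have e1 : am k (z - z') + sm k ((2 : k) • (r - r')) = (ze k A + am k z + (2 : k) • sm k r)
        - (ze k A + am k z' + (2 : k) • sm k r') := by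
      rw [map_sub, map_smul, map_sub]; module
    rw [e1, map_sub, key h, key h', map_sub, map_smul, map_sub]; module
  let f : TKK k A →ₗ[k] TKK k A := eM k y t ∘ₗ eP k x s ∘ₗ eM k z r
  have hf : ∀ P Q, f ⁅P, Q⁆ = ⁅f P, f Q⁆ := fun P Q => by
    change eM k y t (eP k x s (eM k z r ⁅P, Q⁆)) = _
    rw [eM_lie, eP_lie, eM_lie]; rfl
  have hfz : f (ze k A) = -ze k A := h
  have e2 : f (eM k (-z) (-r) (am k (z - z') + sm k ((2 : k) • (r - r')))) =
      eM k y t (am k (y - y') + sm k ((2 : k) • (t - t'))) := by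
    change eM k y t (eP k x s (eM k z r (eM k (-z) (-r) _))) = _
    rw [eM_eM_neg, e]
  rw [eM_am_sm, eM_am_sm, map_add, map_am_mem hf hfz, map_sm_mem hf hfz] at e2
  have c1 := congrArg (cam k) e2
  have c2 := congrArg (csm k) e2
  simp only [map_add, cam_ap, cam_sp, cam_am, cam_sm, csm_ap, csm_sp, csm_am, csm_sm, add_zero,
    zero_add] at c1 c2
  have hyy : y - y' = 0 := c1.symm
  rw [hyy, psiS_zero_right, smul_zero, sub_zero] at c2
  have htt : t - t' = 0 := (smul_eq_zero.mp c2.symm).resolve_left h2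
  rw [hyy, htt, smul_zero, map_zero, map_zero, add_zero] at e
  have e3 : am k (z - z') + sm k ((2 : k) • (r - r')) = 0 := by
    rw [← eP_neg_eP x s (am k (z - z') + _), e, map_zero]
  have c3 := congrArg (cam k) e3
  have c4 := congrArg (csm k) e3
  simp only [map_add, cam_am, cam_sm, csm_am, csm_sm, add_zero, zero_add, map_zero] at c3 c4
  have hrr : r - r' = 0 := (smul_eq_zero.mp c4).resolve_left h2
  exact ⟨⟨(sub_eq_zero.mp hyy).symm, (sub_eq_zero.mp htt).symm⟩, (sub_eq_zero.mp c3).symm,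
    (sub_eq_zero.mp hrr).symm⟩

theorem areTheInverses_of_isSolution {x : A} {s : skew k A} {u : A} {t : skew k A}
    (h : IsSolution k x s u t) :
    AreTheInverses k (x, s) (u - t * x, t) (u + t * x, t) := by
  have h0 := eM_eP_eM_of_isSolution h
  refine ⟨hasInverses_of_map_zeta Fact.out ((eM_eP_eM_ze_iff _ _ _ _ _ _).mp h0), ?_⟩
  rintro ⟨y', t'⟩ ⟨z', r'⟩ ⟨g, ⟨-, -, hg⟩, hg'⟩
  have e1 : (eMinus k (y', t') ∘ₗ ePlus k (x, s) ∘ₗ eMinus k (z', r')) (zeta k A) = -zeta k A := by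
    rw [← hg']; exact hg
  obtain ⟨⟨a, b⟩, c, d⟩ := inverses_unique h0 ((eM_eP_eM_ze_iff _ _ _ _ _ _).mpr e1)
  exact ⟨Prod.ext a b, Prod.ext c d⟩

end

section

variable {k : Type*} {A : Type*} [Field k] [NonAssocRing A] [StarRing A] [Module k A]
  [SMulCommClass k A A] [IsScalarTower k A A]
variable [StructurableAlgebra k A]

/-! ### The reflection attached to an invertible element of `A` -/

variable (k) in
/-- The automorphism `e₋(v, 0) e₊(x, 0) e₋(v, 0)`, which reverses the grading if `v` is the
conjugate inverse of `x`. -/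
def refl (x v : A) : TKK k A →ₗ[k] TKK k A := eM k v 0 ∘ₗ eP k x 0 ∘ₗ eM k v 0

theorem refl_apply (x v : A) (P : TKK k A) :
    refl k x v P = eM k v 0 (eP k x 0 (eM k v 0 P)) := rfl

variable [Fact (IsAlgebraic k A)]
theorem refl_lie (x v : A) (P Q : TKK k A) : refl k x v ⁅P, Q⁆ = ⁅refl k x v P, refl k x v Q⁆ := by
  simp only [refl_apply, eM_lie, eP_lie]

theorem refl_neg_refl (x v : A) (P : TKK k A) : refl k x v (refl k (-x) (-v) P) = P := by
  have h1 := fun Q => eM_eM_neg (k := k) v 0 Q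
  have h2 := fun Q => eP_eP_neg (k := k) x 0 Q
  simp only [neg_zero] at h1 h2
  simp only [refl_apply, h1, h2]

theorem refl_ze {x v : A} (h : IsConjInv k x v) : refl k x v (ze k A) = -ze k A := by
  simpa [refl_apply] using eM_eP_eM_of_isSolution (isSolution_of_isConjInv h)

theorem csp_lie_am (y : A) (P : TKK k A) : csp k ⁅am k y, P⁆ = 0 := by
  rw [decompose k P]
  simp

theorem csp_eM (y : A) (P : TKK k A) : csp k (eM k y 0 P) = csp k P := by
  rw [eM, ex_apply, map_zero, add_zero]
  simp only [map_add, map_smul, csp_lie_am, smul_zero, add_zero]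

/-- `q_x` is of degree `4` in `x`. -/
theorem qS_neg (x : A) (t : skew k A) : qS k (-x) t = qS k x t := by
  have e : ⁅ap k (-x), ⁅ap k (-x), ⁅ap k (-x), ⁅ap k (-x), sm k t⁆⁆⁆⁆ =
      ⁅ap k x, ⁅ap k x, ⁅ap k x, ⁅ap k x, sm k t⁆⁆⁆⁆ := by
    rw [map_neg]
    simp only [neg_lie, lie_neg, neg_neg]
  rw [ad_ap_sm4, ad_ap_sm4] at e
  have h24 := twentyfour_ne_zero k A
  exact sp_injective k (smul_right_injective _ h24 e)

section

variable {x v : A} (h : IsConjInv k x v)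
include h

/-- The component of degree `2` of the image of `t₋` is `ad(x₊)⁴ t₋ / 4!`, as `e₋(v, 0)` fixes `t₋`
and does not affect components of degree `2`. -/
theorem refl_sm (t : skew k A) : refl k x v (sm k t) = sp k (qS k x t) := by
  have h24 := twentyfour_ne_zero k A
  rw [map_sm_mem (refl_lie x v) (refl_ze h)]
  congr 1
  have e : eM k v 0 (sm k t) = sm k t := by
    have := eM_am_sm v 0 0 t
    rwa [map_zero, zero_add, psiS_zero_right, smul_zero, sub_zero, zero_add] at this
  rw [refl_apply, e, csp_eM, eP_sm, ad_ap_sm4, ad_ap_sm3,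
    ad_ap_sm2, smul_smul (24 : k)⁻¹, inv_mul_cancel₀ h24, one_smul, map_zero]
  simp

/-- The inverse of the reflection for `x` is the one for `-x`, which agrees with it on `S₋`. -/
theorem refl_sp (s : skew k A) : refl k x v (sp k s) = sm k (qS k v s) := by
  have h' : IsConjInv k (-x) (-v) := by
    rw [IsConjInv, ← show V k x v = 1 from h]
    ext z; simp [V_apply]
  have e := refl_sm h' (qS k v s)
  rw [qS_neg, qS_qS h.symm] at e
  rw [← e, refl_neg_refl]

end

/-- For `D` of degree `0`, the components of degrees `2` and `0` of the equation
`e₊(x, 0) e₋(v, 0) D = -e₋(-v, 0) D`, which is equivalent to the hypothesis. -/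
theorem of_refl_dz {x v : A} {D : instrl k A} (hD : refl k x v (dz k D) = -dz k D) :
    psiS k x ((D : Module.End k A) x) = 0 ∧ VI k x (eps k D v) = -D := by
  have h2 := StructurableAlgebra.two_ne_zero (k := k) A
  have h3 := StructurableAlgebra.three_ne_zero (k := k) A
  have h6 := inv_six k
  set a : A := eps k D v with ha
  set b : skew k A := psiS k v a with hb
  have e1 : eM k v 0 (dz k D) = dz k D - am k a + sm k b := by
    rw [eM, ex_apply, map_zero, add_zero, lie_am_dz, lie_neg, lie_am_am, lie_neg, lie_smul,
      lie_am_sm, smul_zero, neg_zero, lie_zero, smul_zero, smul_zero, ← ha, ← hb]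
    match_scalars <;> field_simp
  have e2 : eM k (-v) 0 (dz k D) = dz k D + am k a + sm k b := by
    rw [eM, ex_apply, map_zero, add_zero, map_neg]
    simp only [neg_lie, lie_neg, lie_smul, lie_am_dz, lie_am_am, lie_am_sm, neg_neg, smul_zero,
      lie_zero, neg_zero, add_zero, ← ha, ← hb]
    match_scalars <;> field_simp
  have e3 : eP k x 0 (dz k D - am k a + sm k b) = -(dz k D + am k a + sm k b) := by
    have e := eM_neg_eM v 0 (eP k x 0 (eM k v 0 (dz k D)))
    have e' := hD
    rw [refl_apply] at e'
    rw [e', map_neg, neg_zero, e2, e1] at e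
    exact e.symm
  have e4 : eP k x 0 (dz k D) =
      dz k D - ap k ((D : Module.End k A) x) + sp k (psiS k x ((D : Module.End k A) x)) := by
    rw [eP, ex_apply, map_zero, add_zero, lie_ap_dz, lie_neg, lie_ap_ap, lie_neg, lie_smul,
      lie_ap_sp, smul_zero, neg_zero, lie_zero, smul_zero, smul_zero]
    match_scalars <;> field_simp
  rw [map_add, map_sub, e4, eP_am, eP_sm, map_zero] at e3
  simp only [zero_lie, lie_zero, smul_zero, add_zero, lie_ap_am,
    lie_ap_sm, lie_smul, lie_ap_dz, lie_neg, lie_ap_ap] at e3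
  have c1 := congrArg (csm k) e3
  have c3 := congrArg (cdz k) e3
  have c5 := congrArg (csp k) e3
  simp only [map_add, map_sub, map_neg, map_smul, csm_sm, csm_am, csm_dz, csm_ap, csm_sp, cdz_sm,
    cdz_am, cdz_dz, cdz_ap, cdz_sp, csp_sm, csp_am, csp_dz, csp_ap, csp_sp] at c1 c3 c5
  have hb0 : b = 0 := by
    refine (smul_eq_zero.mp (?_ : (2 : k) • b = 0)).resolve_left h2
    linear_combination (norm := module) c1
  have hVI0 : VI k x ((b : A) * x) = 0 := by
    rw [hb0, ZeroMemClass.coe_zero, zero_mul, VI_zero_right]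
  rw [hVI0] at c3
  have hV : VI k x a = -D := by
    refine smul_right_injective _ h2 ?_
    change (2 : k) • _ = (2 : k) • _
    linear_combination (norm := module) c3
  refine ⟨?_, hV⟩
  have hVc : ((VI k x a : instrl k A) : Module.End k A) x = -((D : Module.End k A) x) := by
    rw [hV]; rfl
  have hps : psiS k x (-((D : Module.End k A) x)) = -psiS k x ((D : Module.End k A) x) := by
    rw [← neg_one_smul k, psiS_smul, neg_one_smul]
  have hVI0' : ((VI k x ((b : A) * x) : instrl k A) : Module.End k A) x = 0 := by
    rw [hVI0]; rfl
  rw [hVc, hVI0', neg_zero, hps, psiS_zero_right, h6] at c5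
  refine (smul_eq_zero.mp (?_ : (3 : k)⁻¹ • psiS k x ((D : Module.End k A) x) = 0)).resolve_left
    (inv_ne_zero h3)
  rw [← sub_eq_zero] at c5
  rw [← c5]
  match_scalars
  field_simp
  ring

end

section

variable {k : Type*} {A : Type*} [Field k] [NonAssocRing A] [StarRing A] [Module k A]
  [SMulCommClass k A A] [IsScalarTower k A A]
variable [StructurableAlgebra k A]

/-! ### The inverses of `(x, s)` -/

/-- `L_a` and `-L_b` are inverse endomorphisms of a finite-dimensional space. -/
theorem mul_mul_comm_of_skew {a b : skew k A} (h : ∀ z : A, (a : A) * (b * z) = -z) (z : A) :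
    (b : A) * (a * z) = -z := by
  have : Module.Finite k A := StructurableAlgebra.finite
  have e : LinearMap.mulLeft k (a : A) * -LinearMap.mulLeft k (b : A) = 1 :=
    LinearMap.ext fun w => by simp [h]
  have := LinearMap.congr_fun (mul_eq_one_comm.mp e) z
  simp only [Module.End.mul_apply, LinearMap.neg_apply, LinearMap.mulLeft_apply,
    Module.End.one_apply] at this
  rw [← neg_eq_iff_eq_neg]; exact this

theorem LL_eq_neg_one {a b : skew k A} (h : ∀ z : A, (a : A) * (b * z) = -z) :
    LL k a b = -VI k 1 1 := by
  refine Subtype.ext (LinearMap.ext fun z => ?_)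
  change (a : A) * (b * z) = -V k 1 1 z
  rw [h, V_one_one]; rfl

variable [Fact (IsAlgebraic k A)]

theorem refl_LL {x v : A} (h : IsConjInv k x v) (a b : skew k A) :
    refl k x v (dz k (LL k b a)) = -dz k (LL k (qS k x a) (qS k v b)) := by
  rw [← lie_sp_sm, refl_lie, refl_sp h, refl_sm h, ← lie_skew, lie_sp_sm]

/-- If `L_b L_a = -id`, then `L_{q_x(a)} L_{q_{x̂}(b)} = -id`: apply the reflection to
`[b₊, a₋] = -ζ`. -/
theorem qS_mul_qS_mul {x v : A} (h : IsConjInv k x v) {a b : skew k A}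
    (hab : ∀ z : A, (b : A) * (a * z) = -z) (z : A) : (qS k x a : A) * (qS k v b * z) = -z := by
  have e := refl_LL h a b
  rw [LL_eq_neg_one hab, map_neg, map_neg, ← ze_eq, refl_ze h, ze_eq, neg_neg, ← map_neg] at e
  have e1 := congrArg Subtype.val (dz_injective k e)
  have e2 := LinearMap.congr_fun e1 z
  change V k 1 1 z = -((qS k x a : A) * (qS k v b * z)) at e2
  rw [V_one_one, Module.End.one_apply] at e2
  exact neg_eq_iff_eq_neg.mp e2.symm

theorem qS_add {x v : A} (h : IsConjInv k x v) (a b : skew k A) :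
    qS k x (a + b) = qS k x a + qS k x b := by
  apply sp_injective k
  rw [map_add, ← refl_sm h, ← refl_sm h, ← refl_sm h, map_add, map_add]

theorem qS_smul {x v : A} (h : IsConjInv k x v) (c : k) (a : skew k A) :
    qS k x (c • a) = c • qS k x a := by
  apply sp_injective k
  rw [map_smul, ← refl_sm h, ← refl_sm h, map_smul, map_smul]

/-- If `q_{x̂}(s) = -ŝ`, then `V_{y,w} = 0` for `y = x ± s x̂` and `w = x̂ ∓ ŝ x`, which forces
`w = 0` for both signs, and hence `x̂ = 0`. -/
theorem qS_add_ne_zero (hdiv : IsDivision k A) {x v : A} (hx : x ≠ 0) (h : IsConjInv k x v)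
    {s s' : skew k A} (hs : ∀ z : A, (s : A) * (s' * z) = -z) : qS k v s + s' ≠ 0 := by
  intro h0
  have h2 := StructurableAlgebra.two_ne_zero (k := k) A
  have hs2 := mul_mul_comm_of_skew hs
  have hq : qS k x s' = -s := by
    have e := qS_qS h.symm s
    rw [eq_neg_of_add_eq_zero_left h0, ← neg_one_smul k, qS_smul h, neg_one_smul] at e
    rw [← e, neg_neg]
  have hV1 : VI k (s * v) v = VI k x (s' * x) := by
    have e : ⁅am k v, ⁅am k v, ⁅ap k x, ⁅ap k x, ⁅ap k x, ⁅ap k x, sm k s'⁆⁆⁆⁆⁆⁆ =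
        (24 : k) • ⁅ap k x, ⁅ap k x, sm k s'⁆⁆ := by
      rw [am_ap_sm4 h, lie_smul, am_ap_sm3 h, smul_smul]; norm_num
    rw [ad_ap_sm4, hq, map_neg, smul_neg, lie_neg, lie_neg, lie_smul, lie_smul, ad_am_sp2,
      ad_ap_sm2] at e
    refine dz_injective k (smul_right_injective _
      (mul_ne_zero h2 (twentyfour_ne_zero k A)) ?_)
    change (2 * 24 : k) • _ = (2 * 24 : k) • _
    linear_combination (norm := module) e
  have hpsi : psiS k v (s' * x) = (-2 : k) • s' := by
    refine Subtype.ext ?_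
    have e := delta_V k v x s'.2
    rw [show V k v x = 1 from h.symm, delta_apply] at e
    change psi v ((s' : A) * x) = (-2 : k) • (s' : A)
    simp only [Module.End.one_apply, star_one, mul_one] at e
    linear_combination (norm := module) e
  have hV2 : VI k (s * v) (s' * x) = VI k 1 1 := by
    have e := V_mul_left_sub s v (s' * x)
    rw [hs, hpsi, LL_smul_right, LL_eq_neg_one hs, VI_neg_left,
      VI_of_isConjInv h] at e
    linear_combination (norm := module) e
  -- for `y = x + ε s v` with `y = 0`, the element `w = v - ε s' x` is `v - ε² v`
  have key : ∀ ε : k, ε * ε = 1 → v - ε • (s' * x) = 0 := by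
    intro ε hε
    by_cases hy : x + ε • ((s : A) * v) = 0
    · have e : (s' : A) * (x + ε • (s * v)) = 0 := by rw [hy, mul_zero]
      rw [mul_add, mul_smul_comm, hs2] at e
      have e1 : (s' : A) * x = ε • v := by linear_combination (norm := module) e
      rw [e1, smul_smul, hε, one_smul, sub_self]
    · refine eq_zero_of_V_eq_zero (isConjInv_conjInv hdiv hy) (congrArg Subtype.val
        (?_ : VI k (x + ε • ((s : A) * v)) (v - ε • (s' * x)) = 0))
      rw [sub_eq_add_neg, ← neg_smul, VI_add_left, VI_add_right, VI_add_right, VI_smul_left,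
        VI_smul_left, VI_smul_right, VI_smul_right, hV1, hV2, VI_of_isConjInv h, smul_smul,
        mul_neg, hε]
      module
  have e1 := key 1 (one_mul 1)
  have e2 := key (-1) (by ring)
  have hv : v = 0 := by
    refine (smul_eq_zero.mp (?_ : (2 : k) • v = 0)).resolve_left h2
    linear_combination (norm := module) e1 + e2
  apply hx
  have e := LinearMap.congr_fun (show V k x v = 1 from h) x
  rw [hv, show V k x 0 = 0 from congrArg Subtype.val (VI_zero_right k x)] at e
  exact e.symm

section Solution

variable {x v : A} (h : IsConjInv k x v) {s s' m' : skew k A}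
  (hs : ∀ z : A, (s : A) * (s' * z) = -z)
  (hm : ∀ z : A, ((qS k v s + s' : skew k A) : A) * (m' * z) = -z)
include h hs hm

/-- `L_m̂ L_r = L_s L_t` for `r = q_{x̂}(s)`, `m = r + ŝ` and `t = q_{x̂}(m̂)`. This is
`L_r L_n = L_m L_s` for `n = q_x(m) = s + q_x(ŝ)`, because `L_r L_{q_x(ŝ)} = -id = L_ŝ L_s` and
`L_n L_t = -id = L_m L_m̂`. -/
theorem LL_eq_LL : LL k m' (qS k v s) = LL k s (qS k v m') := by
  refine Subtype.ext (LinearMap.ext fun z => ?_)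
  change (m' : A) * (qS k v s * z) = s * (qS k v m' * z)
  have hm2 := mul_mul_comm_of_skew hm
  have hq := mul_mul_comm_of_skew (qS_mul_qS_mul h hs)
  have hn := qS_mul_qS_mul h hm2 z
  rw [qS_add h, qS_qS h.symm] at hn
  have e1 := hm2 ((s : A) * (qS k v m' * z))
  have e2 := congrArg (fun w => (m' : A) * (qS k v s * w)) hn
  have hs2 := mul_mul_comm_of_skew hs
  simp only [Submodule.coe_add, add_mul, mul_add, mul_neg, hq, hs2] at e1 e2
  linear_combination (norm := module) e2 - e1

/-- With `m = q_{x̂}(s) + ŝ`, the pair of `u = -ŝ (m̂ x̂)` and `t = q_{x̂}(m̂)` solves the system.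
The operator `D = L_s L_t` satisfies `refl D = -D`, which gives the third equation and, as
`u = x̂ + q_{x̂}(s) (m̂ x̂)`, the first one. The second one is `[x̂₋, ad(x₊)⁴ t₋] = -4 ad(x₊)³ t₋`,
where `ad(x₊)⁴ t₋ = 24 m̂₊`. -/
theorem isSolution_of_inverses :
    IsSolution k x s (-((s' : A) * (m' * v))) (qS k v m') := by
  have h2 := StructurableAlgebra.two_ne_zero (k := k) A
  have h3 := StructurableAlgebra.three_ne_zero (k := k) A
  have hD : refl k x v (dz k (LL k m' (qS k v s))) = -dz k (LL k m' (qS k v s)) := by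
    rw [refl_LL h, qS_qS h.symm, LL_eq_LL h hs hm]
  obtain ⟨hpsi, hV⟩ := of_refl_dz hD
  have hu : -((s' : A) * (m' * v)) = v + qS k v s * (m' * v) := by
    have := hm v
    rw [Submodule.coe_add, add_mul] at this
    linear_combination (norm := module) -this
  refine ⟨?_, ?_, ?_⟩
  · rw [eps_LL, VI_neg_right, neg_inj, LL_eq_LL h hs hm] at hV
    have e := congrArg Subtype.val (VI_add_right k x v (qS k v s * (m' * v)))
    rw [← hu, hV, VI_of_isConjInv h] at e
    refine e.trans ?_
    change V k 1 1 + _ = _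
    rw [V_one_one]; rfl
  · have e := am_ap_sm4 h (qS k v m')
    rw [ad_ap_sm4, ad_ap_sm3, qS_qS h.symm, lie_smul, ← lie_skew, lie_sp_am, ← map_neg,
      ← map_smul, ← map_smul, ← map_smul] at e
    have e' := ap_injective k e
    rw [mul_neg, hs, neg_neg]
    have h24 := twentyfour_ne_zero k A
    refine smul_right_injective _ h24 ?_
    change (24 : k) • _ = (24 : k) • _
    have h8 : (24 : k) • (3 : k)⁻¹ • U k x (qS k v m' * x) = (8 : k) • U k x (qS k v m' * x) := by
      rw [smul_smul]; congr 1; field_simp; norm_num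
    rw [smul_neg, h8]
    linear_combination (norm := module) -e'
  · rw [LL_eq_LL h hs hm] at hpsi
    exact congrArg Subtype.val hpsi

/-- The first argument is `-s (m x)` for `m = q_{x̂}(s) + ŝ`. Since `V_{x,u} = -L_m̂ L_ŝ` commutes
with `D = L_s L_m`, the Jacobi identity for `D`, `x₊` and `u₋` gives `V_{Dx,u} + V_{x,D^ε u} = 0`,
where `D^ε u = x̂`. -/
theorem isConjInv_sub : IsConjInv k (x - s * (qS k v s * x)) (-((s' : A) * (m' * v))) := by
  have h2 := StructurableAlgebra.two_ne_zero (k := k) A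
  have hm2 := mul_mul_comm_of_skew hm
  have hs2 := mul_mul_comm_of_skew hs
  set u : A := -((s' : A) * (m' * v)) with hu
  set m : skew k A := qS k v s + s' with hm0
  have hd : x - s * (qS k v s * x) = -((s : A) * (m * x)) := by
    rw [hm0, Submodule.coe_add, add_mul, mul_add, hs]; module
  have hV : ∀ z : A, V k x u z = -((m' : A) * (s' * z)) := by
    intro z
    rw [(isSolution_of_inverses h hs hm).1]
    have e1 := hm2 z
    have e2 := LinearMap.congr_fun (congrArg Subtype.val (LL_eq_LL h hs hm)) z
    change (m' : A) * (qS k v s * z) = s * (qS k v m' * z) at e2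
    rw [hm0, Submodule.coe_add, add_mul, mul_add] at e1
    change z + (s : A) * (qS k v m' * z) = _
    rw [← e2]
    linear_combination (norm := module) e1
  have hcomm : commI k (LL k s m) (VI k x u) = 0 := by
    refine Subtype.ext (LinearMap.ext fun z => ?_)
    change (s : A) * (m * (V k x u z)) - V k x u (s * (m * z)) = 0
    rw [hV, hV, mul_neg, hm, neg_neg, hs, hs2, mul_neg, neg_neg, hm2, sub_self]
  have e := leibniz_lie (dz k (LL k s m)) (ap k x) (am k u)
  have heps : eps k (LL k s m : instrl k A) u = v := by
    rw [eps_LL, hu, mul_neg, hs, neg_neg, hm, neg_neg]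
  rw [lie_ap_am, lie_smul, lie_dz_dz, hcomm, map_zero, smul_zero, lie_dz_ap, lie_dz_am, heps,
    lie_ap_am, lie_ap_am, VI_of_isConjInv h, ← smul_add, ← map_add] at e
  have e' := dz_injective k ((map_zero _).trans
    ((smul_eq_zero.mp e.symm).resolve_left (neg_ne_zero.mpr h2)).symm)
  change V k _ u = 1
  have e3 : VI k (x - s * (qS k v s * x)) u = VI k 1 1 := by
    rw [hd, VI_neg_left]
    exact neg_eq_of_add_eq_zero_right e'.symm
  rw [← V_one_one]
  exact congrArg Subtype.val e3

end Solution

theorem areTheInverses_of_isConjInv {x v : A} (h : IsConjInv k x v) :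
    AreTheInverses k (x, 0) (v, 0) (v, 0) := by
  simpa using areTheInverses_of_isSolution (isSolution_of_isConjInv h)

end

end Structurable

open Structurable in
theorem mainTheorem7 {k : Type*} {A : Type*} [Field k] [NonAssocRing A] [StarRing A] [Module k A]
    [SMulCommClass k A A] [IsScalarTower k A A] [StructurableAlgebra k A]
    (halg : IsAlgebraic k A) (hdiv : IsDivision k A) :
    -- the pairs with both components nonzero
    (∀ (x : A) (s : skew k A), x ≠ 0 → s ≠ 0 →
      OneInvertible k (x, s) ∧
      x - s * (q k (conjInv k x) s * x) ≠ 0 ∧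
      q k (conjInv k x) s + conjInv k (s : A) ≠ 0 ∧
      s + q k x (conjInv k (s : A)) ≠ 0 ∧
      ∃ (u : A) (t : skew k A),
        u = conjInv k (x - s * (q k (conjInv k x) s * x)) ∧
        u = -(conjInv k (s : A) *
          (conjInv k (q k (conjInv k x) s + conjInv k (s : A)) * conjInv k x)) ∧
        (t : A) = conjInv k (s + q k x (conjInv k (s : A))) ∧
        IsSolution k x s u t ∧
        (∀ (u' : A) (t' : skew k A), IsSolution k x s u' t' → u' = u ∧ t' = t) ∧
        AreTheInverses k (x, s) (u - t * x, t) (u + t * x, t)) ∧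
    -- the pairs with exactly one nonzero component
    (∀ x : A, x ≠ 0 → AreTheInverses k (x, 0) (conjInv k x, 0) (conjInv k x, 0)) ∧
    (∀ s : skew k A, s ≠ 0 → ∃ s' : skew k A, (s' : A) = conjInv k (s : A) ∧
      AreTheInverses k (0, s) (0, s') (0, s')) ∧
    -- all nonzero pairs
    (∀ p : A × skew k A, p ≠ 0 → OneInvertible k p) := by
  have : Fact (IsAlgebraic k A) := ⟨halg⟩
  have h1 : ∀ (x : A) (s : skew k A), x ≠ 0 → s ≠ 0 →
      x - s * (q k (conjInv k x) s * x) ≠ 0 ∧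
      q k (conjInv k x) s + conjInv k (s : A) ≠ 0 ∧
      s + q k x (conjInv k (s : A)) ≠ 0 ∧
      ∃ (u : A) (t : skew k A),
        u = conjInv k (x - s * (q k (conjInv k x) s * x)) ∧
        u = -(conjInv k (s : A) *
          (conjInv k (q k (conjInv k x) s + conjInv k (s : A)) * conjInv k x)) ∧
        (t : A) = conjInv k (s + q k x (conjInv k (s : A))) ∧ IsSolution k x s u t := by
    intro x s hx hs0
    have h := isConjInv_conjInv hdiv hx
    obtain ⟨s', hs', hs, hs2⟩ := exists_skew_inverse hdiv hs0
    have hm0 := qS_add_ne_zero hdiv hx h hs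
    obtain ⟨m', hm', hm, hm2⟩ := exists_skew_inverse hdiv hm0
    have hn := qS_mul_qS_mul h hm2
    rw [qS_add h, qS_qS h.symm] at hn
    have hd := isConjInv_sub h hs hm
    rw [← hs']
    refine ⟨fun h0 => hx ?_, fun h0 => hm0 (Subtype.ext h0), fun h0 => hx ?_,
      -((s' : A) * (m' * conjInv k x)), qS k (conjInv k x) m', (conjInv_eq hd).symm, ?_,
      (conjInv_eq (isConjInv_of_mul_mul hn)).symm, isSolution_of_inverses h hs hm⟩
    · have e := LinearMap.congr_fun (show V k _ _ = 1 from hd) x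
      change V k (x - s * (q k (conjInv k x) s * x)) _ x = x at e
      rw [h0, V_apply] at e
      simpa using e.symm
    · have e := hn x
      have h0' : ((s + qS k x s' : skew k A) : A) = 0 := h0
      rw [h0', zero_mul] at e
      exact neg_eq_zero.mp e.symm
    · rw [hm']; rfl
  have h2 : ∀ s : skew k A, s ≠ 0 → ∃ s' : skew k A, (s' : A) = conjInv k (s : A) ∧
      AreTheInverses k (0, s) (0, s') (0, s') := by
    intro s hs0
    obtain ⟨s', hs', hs, -⟩ := exists_skew_inverse hdiv hs0
    exact ⟨s', hs', by simpa using areTheInverses_of_isSolution (isSolution_skew hs)⟩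
  refine ⟨fun x s hx hs => ?_, fun x hx => areTheInverses_of_isConjInv (isConjInv_conjInv hdiv hx),
    h2, ?_⟩
  · obtain ⟨hd, hm, hn, u, t, hu, hu', ht, hsol⟩ := h1 x s hx hs
    have hinv := areTheInverses_of_isSolution hsol
    refine ⟨⟨_, _, hinv.1⟩, hd, hm, hn, u, t, hu, hu', ht, hsol, fun u' t' hsol' => ?_, hinv⟩
    obtain ⟨e1, e2⟩ := hinv.2 _ _ (areTheInverses_of_isSolution hsol').1
    have et : t' = t := (Prod.ext_iff.mp e1).2
    have eu : u' - t' * x = u - t * x := (Prod.ext_iff.mp e1).1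
    rw [et, sub_left_inj] at eu
    exact ⟨eu, et⟩
  · rintro ⟨x, s⟩ hp
    by_cases hx : x = 0
    · subst hx
      have hs : s ≠ 0 := fun hs => hp (by rw [hs]; rfl)
      obtain ⟨s', -, hinv⟩ := h2 s hs
      exact ⟨_, _, hinv.1⟩
    · by_cases hs : s = 0
      · subst hs
        exact ⟨_, _, (areTheInverses_of_isConjInv (isConjInv_conjInv hdiv hx)).1⟩
      · obtain ⟨-, -, -, u, t, -, -, -, hsol⟩ := h1 x s hx hs
        exact ⟨_, _, (areTheInverses_of_isSolution hsol).1⟩
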